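/- Let $d\ge 0$, $\mathbf a\in\mathbb R^d$, and let $\mu_1$ be any Borel probability measure on $\mathbb R^d$. For a reference SDE $d\mathbf x_t=\mathbf b(\mathbf x_t,t)\,dt+\sigma(t)\,d\mathbf w_t$ on $[0,1]$ with (continuous) transition density $q(s,\mathbf x,t,\mathbf y)$, the extra drift of the Schrödinger bridge from $\delta_{\mathbf a}$ to $\mu_1$ is $$\mathbf u^\star(\mathbf x,t)=\frac{\sigma(t)^2\int\nabla_{\mathbf x}g_t(\mathbf x,\mathbf x_1)\,\mu_1(d\mathbf x_1)}{\int g_t(\mathbf x,\mathbf x_1)\,\mu_1(d\mathbf x_1)},\qquad g_t(\mathbf x,\mathbf x_1)=\frac{q(t,\mathbf x,1,\mathbf x_1)}{q(0,\mathbf a,1,\mathbf x_1)} .$$ Given a target $\mathbf y_t(\mathbf x_1,\mathbf x)$, means $\mathbf m_t(\mathbf x_1)$ and variances $s_t^2$, put, with values in $[0,\infty]$, $$L_t(\mathbf v)=\mathbb E\|\mathbf y_t(\mathbf x_1,\mathbf x_t)-\mathbf v(\mathbf x_t)\|^2,\quad \mathbf x_1\sim\mu_1,\ \ \mathbf x_t\mid\mathbf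 x_1\sim N(\mathbf m_t(\mathbf x_1),s_t^2\mathbf I_d),\qquad L(\mathbf u)=\mathbb E_{t\sim U(0,1)}L_t(\mathbf u(\cdot,t)).$$ We say that $\mathbf u^\star$ is the unique minimizer if it is Lebesgue measurable on $\mathbb R^d\times(0,1)$ and the following hold among Lebesgue measurable vector fields: (a) $L(\mathbf u^\star)\le L(\mathbf u)$ for all $\mathbf u$; and if $L(\mathbf u^\star)<\infty$, then $L(\mathbf u)=L(\mathbf u^\star)$ if and only if $\mathbf u=\mathbf u^\star$ almost everywhere on $\mathbb R^d\times(0,1)$; (b) for every $t\in(0,1)$, $\mathbf u^\star(\cdot,t)$ is Lebesgue measurable, $L_t(\mathbf u^\star(\cdot,t))<\infty$, $L_t(\mathbf u^\star(\cdot,t))\le L_t(\mathbf v)$ for all $\mathbf v$, and equality holds if and only if $\mathbf v=\mathbf u^\star(\cdot,t)$ almost everywhere on $\mathbb R^d$. 1. Let $\alpha$ be continuously differentiable and strictly increasing on $[0,1]$. For the reference SDE $d\mathbf x_t=\sqrt{\alpha'(t)}\,d\mathbf w_t$, $\mathbf u^\star$ is the unique minimizer for $$\mathbf y_t=\frac{\alpha'(t)}{\alpha(1)-\alpha(t)}(\mathbf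 x_1-\mathbf x_t),\quad \mathbf m_t(\mathbf x_1)=\frac{\alpha(t)-\alpha(0)}{\alpha(1)-\alpha(0)}\mathbf x_1+\frac{\alpha(1)-\alpha(t)}{\alpha(1)-\alpha(0)}\mathbf a,\quad s_t^2=\frac{[\alpha(t)-\alpha(0)][\alpha(1)-\alpha(t)]}{\alpha(1)-\alpha(0)} .$$ 2. Let $\beta\ge 0$ be continuous on $[0,1]$ with $\int_s^t\beta>0$ for all $0\le s<t\le 1$. For the reference SDE $d\mathbf x_t=-\frac12\beta(t)\mathbf x_t\,dt+\sqrt{\beta(t)}\,d\mathbf w_t$, $\mathbf u^\star$ is the unique minimizer for $$\mathbf y_t=\frac{\beta(t)\xi}{1-\xi^2}(\mathbf x_1-\xi\mathbf x_t),\quad \mathbf m_t(\mathbf x_1)=\frac{\sigma_2^2}{\xi\sigma^2}\mathbf x_1+\frac{\tau\sigma_2^2}{\xi\sigma_1^2}\mathbf a,\quad s_t^2=\frac{(\sigma_2^2)^2}{\xi^2\sigma^2},$$ where $\xi=e^{-\frac12\int_t^1\beta(s')ds'}$, $\tau=e^{-\frac12\int_0^1\beta(s')ds'}$, $\sigma_1^2=1-\tau^2$,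 $\sigma_2^2=1-\xi^2$, $\sigma^2=\left(\frac1{\sigma_2^2}-\frac1{\sigma_1^2}\right)^{-1}$. -/

import Mathlib

open MeasureTheory ProbabilityTheory Set Filter
open scoped NNReal ENNReal

noncomputable section

namespace SchrodingerBridge

/-- `ℝ^d` with its Euclidean structure. -/
abbrev E (d : ℕ) : Type := EuclideanSpace ℝ (Fin d)

/-! ### Stochastic differential equations with a deterministic scalar diffusion coefficient -/

/-- `W` is a standard `d`-dimensional Brownian motion with respect to the filtration `ℱ`:
its coordinates are independent real Brownian motions, it is adapted, and its increments
after time `s` are independent of `ℱ s`. -/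
structure IsBrownianMotion {d : ℕ} {Ω : Type} {mΩ : MeasurableSpace Ω} (P : Measure Ω)
    (ℱ : Filtration ℝ≥0 mΩ) (W : ℝ≥0 → Ω → E d) : Prop where
  coord : ∀ i, IsBrownianReal (fun t ω ↦ W t ω i) P
  indep_coord : iIndepFun (fun (i : Fin d) (ω : Ω) (t : ℝ≥0) ↦ W t ω i) P
  adapted : ∀ t, StronglyMeasurable[ℱ t] (W t)
  indep_increment : ∀ s t, s ≤ t →
    Indep (MeasurableSpace.comap (fun ω ↦ W t ω - W s ω) inferInstance) (ℱ s) P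

/-- Left-endpoint Riemann sum of `∫_s^t σ(r) dW_r` over the uniform partition of `[s, t]`
into `n` intervals. -/
def itoSum {d : ℕ} {Ω : Type} (σ : ℝ → ℝ) (W : ℝ≥0 → Ω → E d) (s t : ℝ) (n : ℕ) (ω : Ω) :
    E d :=
  ∑ k ∈ Finset.range n, σ (s + k * ((t - s) / n)) •
    (W (s + (k + 1) * ((t - s) / n)).toNNReal ω - W (s + k * ((t - s) / n)).toNNReal ω)

/-- `X` solves `dX_t = b(X_t, t) dt + σ(t) dW_t` on `[s, 1]` with `X_s = x`, for `σ` deterministic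
and continuous: `X` is adapted with continuous paths, and for every `t`,
`X_t - x - ∫_s^t b(X_r, r) dr = ∫_s^t σ(r) dW_r` almost surely. The stochastic integral of a
continuous integrand is the limit in probability of its left-endpoint Riemann sums. -/
structure IsSDESolution {d : ℕ} {Ω : Type} {mΩ : MeasurableSpace Ω} (P : Measure Ω)
    (ℱ : Filtration ℝ≥0 mΩ) (W : ℝ≥0 → Ω → E d) (b : E d → ℝ → E d) (σ : ℝ → ℝ)
    (s : ℝ) (x : E d) (X : ℝ → Ω → E d) : Prop where
  adapted : ∀ t ∈ Icc s 1, StronglyMeasurable[ℱ t.toNNReal] (X t)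
  continuous_paths : ∀ᵐ ω ∂P, ContinuousOn (fun t ↦ X t ω) (Icc s 1)
  integrable_drift : ∀ᵐ ω ∂P, IntervalIntegrable (fun r ↦ b (X r ω) r) volume s 1
  equation : ∀ t ∈ Icc s 1,
    TendstoInMeasure P (itoSum σ W s t) atTop
      (fun ω ↦ X t ω - x - ∫ r in s..t, b (X r ω) r)

/-- `q s x t y` is the (continuous) transition density of `dX_t = b(X_t, t) dt + σ(t) dW_t`: for
`0 ≤ s < t ≤ 1`, the solution that starts from `x` at time `s` has at time `t` a law with
density `y ↦ q s x t y`. Continuity in `y` singles out one version of the density. -/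
structure IsTransitionDensity {d : ℕ} (b : E d → ℝ → E d) (σ : ℝ → ℝ)
    (q : ℝ → E d → ℝ → E d → ℝ) : Prop where
  nonneg : ∀ s t, 0 ≤ s → s < t → t ≤ 1 → ∀ x y, 0 ≤ q s x t y
  continuous : ∀ s t, 0 ≤ s → s < t → t ≤ 1 → ∀ x, Continuous (q s x t)
  law : ∀ s, 0 ≤ s → s < 1 → ∀ x : E d,
    ∃ (Ω : Type) (mΩ : MeasurableSpace Ω) (P : Measure Ω) (ℱ : Filtration ℝ≥0 mΩ)
      (W : ℝ≥0 → Ω → E d) (X : ℝ → Ω → E d),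
      IsBrownianMotion P ℱ W ∧ IsSDESolution P ℱ W b σ s x X ∧
      ∀ t, s < t → t ≤ 1 →
        P.map (X t) = (volume : Measure (E d)).withDensity (fun y ↦ ENNReal.ofReal (q s x t y))

/-! ### The drift of the bridge from `δ_a` to `μ₁` -/

/-- `g_t(x, x₁) = q(t, x, 1, x₁) / q(0, a, 1, x₁)`. -/
def bridgeRatio {d : ℕ} (q : ℝ → E d → ℝ → E d → ℝ) (a : E d) (t : ℝ) (x x₁ : E d) : ℝ :=
  q t x 1 x₁ / q 0 a 1 x₁

/-- `u⋆(x, t) = σ(t)² ∫ ∇ₓ g_t(x, x₁) μ₁(dx₁) / ∫ g_t(x, x₁) μ₁(dx₁)`. -/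
def bridgeDrift {d : ℕ} (σ : ℝ → ℝ) (q : ℝ → E d → ℝ → E d → ℝ) (a : E d)
    (μ₁ : Measure (E d)) (x : E d) (t : ℝ) : E d :=
  (σ t ^ 2 / ∫ x₁, bridgeRatio q a t x x₁ ∂μ₁) •
    ∫ x₁, gradient (fun x' ↦ bridgeRatio q a t x' x₁) x ∂μ₁

/-! ### Quadratic regression losses -/

/-- The loss at time `t` of a vector field `v`: the expectation of `‖y t x₁ x - v x‖²`
for `x₁ ∼ μ₁` and `x | x₁ ∼ N(m t x₁, s2 t · I_d)`, with values in `[0, ∞]`. -/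
def lossAt {d : ℕ} (μ₁ : Measure (E d)) (m : ℝ → E d → E d) (s2 : ℝ → ℝ)
    (y : ℝ → E d → E d → E d) (t : ℝ) (v : E d → E d) : ℝ≥0∞ :=
  ∫⁻ x₁, ∫⁻ x, ‖y t x₁ x - v x‖ₑ ^ 2
    ∂(multivariateGaussian (m t x₁) (s2 t • (1 : Matrix (Fin d) (Fin d) ℝ))) ∂μ₁

/-- The loss of a time-dependent vector field `u`: the expectation of
`‖y t x₁ x - u x t‖²` for `t ∼ U(0, 1)`, `x₁ ∼ μ₁` and `x | x₁ ∼ N(m t x₁, s2 t · I_d)`,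
with values in `[0, ∞]`. -/
def loss {d : ℕ} (μ₁ : Measure (E d)) (m : ℝ → E d → E d) (s2 : ℝ → ℝ)
    (y : ℝ → E d → E d → E d) (u : E d → ℝ → E d) : ℝ≥0∞ :=
  ∫⁻ t in Ioo (0 : ℝ) 1, lossAt μ₁ m s2 y t (fun x ↦ u x t)

/-- Lebesgue measure on `ℝ^d × (0, 1)`. -/
def spaceTime (d : ℕ) : Measure (E d × ℝ) :=
  (volume : Measure (E d)).prod (volume.restrict (Ioo (0 : ℝ) 1))

/-- `w` is the unique minimizer of the regression loss with target `y`, up to null sets, among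
the measurable vector fields. The minimal loss over all times can be infinite, and then every
field attains it; so uniqueness for the loss over all times is stated when the minimum is finite,
and uniqueness at every single time, where the minimum is finite, is stated unconditionally. -/
structure IsUniqueMinimizer {d : ℕ} (μ₁ : Measure (E d)) (m : ℝ → E d → E d) (s2 : ℝ → ℝ)
    (y : ℝ → E d → E d → E d) (w : E d → ℝ → E d) : Prop where
  measurable : AEStronglyMeasurable (fun p : E d × ℝ ↦ w p.1 p.2) (spaceTime d)
  minimal : ∀ u : E d → ℝ → E d,
    AEStronglyMeasurable (fun p : E d × ℝ ↦ u p.1 p.2) (spaceTime d) →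
      loss μ₁ m s2 y w ≤ loss μ₁ m s2 y u
  unique : loss μ₁ m s2 y w < ∞ → ∀ u : E d → ℝ → E d,
    AEStronglyMeasurable (fun p : E d × ℝ ↦ u p.1 p.2) (spaceTime d) →
      (loss μ₁ m s2 y u = loss μ₁ m s2 y w ↔
        (fun p : E d × ℝ ↦ u p.1 p.2) =ᵐ[spaceTime d] fun p ↦ w p.1 p.2)
  measurable_at : ∀ t ∈ Ioo (0 : ℝ) 1, AEStronglyMeasurable (fun x ↦ w x t) volume
  finite_at : ∀ t ∈ Ioo (0 : ℝ) 1, lossAt μ₁ m s2 y t (fun x ↦ w x t) < ∞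
  minimal_at : ∀ t ∈ Ioo (0 : ℝ) 1, ∀ v : E d → E d, AEStronglyMeasurable v volume →
    lossAt μ₁ m s2 y t (fun x ↦ w x t) ≤ lossAt μ₁ m s2 y t v
  unique_at : ∀ t ∈ Ioo (0 : ℝ) 1, ∀ v : E d → E d, AEStronglyMeasurable v volume →
    (lossAt μ₁ m s2 y t v = lossAt μ₁ m s2 y t (fun x ↦ w x t) ↔
      v =ᵐ[volume] fun x ↦ w x t)

/-! ### Coefficients for the time-varying Ornstein-Uhlenbeck reference -/

/-- `ξ = exp(-½ ∫_t^1 β)`. -/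
def xi (β : ℝ → ℝ) (t : ℝ) : ℝ := Real.exp (-(1 / 2) * ∫ r in t..1, β r)

/-- `τ = exp(-½ ∫_0^1 β)`. -/
def tau (β : ℝ → ℝ) : ℝ := Real.exp (-(1 / 2) * ∫ r in (0 : ℝ)..1, β r)

/-- `σ₁² = 1 - τ²`. -/
def sigma1Sq (β : ℝ → ℝ) : ℝ := 1 - tau β ^ 2

/-- `σ₂² = 1 - ξ²`. -/
def sigma2Sq (β : ℝ → ℝ) (t : ℝ) : ℝ := 1 - xi β t ^ 2

/-- `σ² = (1/σ₂² - 1/σ₁²)⁻¹`. -/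
def sigmaSq (β : ℝ → ℝ) (t : ℝ) : ℝ := (1 / sigma2Sq β t - 1 / sigma1Sq β)⁻¹

end SchrodingerBridge

end

open scoped Topology

/-! The reference SDE is linear, so its transition density is an explicit Gaussian, and the
regression problem draws `x` from the reference process pinned at `a` and `x₁`. Up to a factor free
of `x₁`, the density of `x` given `x₁` is therefore the ratio `g_t(x, x₁)`
(`exists_gaussDensity_eq_mul_div`). For a Gaussian `q`, `σ² ∇ₓ g_t` equals `g_t` times the target
`y_t`. Hence `u⋆` is the average of `y_t` over `x₁` with weights `g_t`, that is, the conditional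
expectation of the target given `x` (`bridgeDrift_eq_posteriorMean`).

A conditional expectation is the unique least-squares predictor. The bias-variance identity
`lintegral_mul_enorm_sub_sq`, integrated over `x`, writes the loss of any field as the loss of the
posterior mean plus a squared distance weighted by the marginal density of `x`. That density is
positive everywhere, so the extra term vanishes only for fields equal almost everywhere to the
posterior mean. `μ₁` need not have moments: the Gaussian likelihood supplies the integrability, and
an explicit affine predictor has finite loss at each time.

To identify `q`, note that the integrand is deterministic. Pathwise, variation of constants
expresses `X_t` through Riemann sums of the decay factor against the martingale part. These are
limits of weighted sums of independent Brownian increments, so the characteristic function of `X_t`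
is computable (`IsSDESolution.charFun_map`). Continuity of `q` in its last argument turns equality
of laws into pointwise equality. -/

namespace SchrodingerBridge

/-! ### Isotropic Gaussian densities and their characteristic functions -/

/-- The density of the isotropic Gaussian `N(m, v · I_d)`. -/
noncomputable def gaussDensity {d : ℕ} (m : E d) (v : ℝ) (y : E d) : ℝ :=
  (2 * Real.pi * v) ^ (-(d / 2 : ℝ)) * Real.exp (-(‖y - m‖ ^ 2 / (2 * v)))

lemma gaussDensity_pos {d : ℕ} (m : E d) {v : ℝ} (hv : 0 < v) (y : E d) :
    0 < gaussDensity m v y := by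
  unfold gaussDensity
  positivity

lemma continuous_gaussDensity {d : ℕ} (m : E d) (v : ℝ) : Continuous (gaussDensity m v) := by
  unfold gaussDensity
  fun_prop

lemma integral_exp_neg_norm_sq {d : ℕ} {v : ℝ} (hv : 0 < v) :
    ∫ y : E d, Real.exp (-(‖y‖ ^ 2 / (2 * v))) = (2 * Real.pi * v) ^ (d / 2 : ℝ) := by
  have h := GaussianFourier.integral_rexp_neg_mul_sq_norm (V := E d) (b := 1 / (2 * v))
    (by positivity)
  convert h using 2
  · ext y; congr 1; field_simp
  · field_simp
  · simp

/-- Centre at `m` and evaluate the complex Gaussian integral with linear term `I ⟪ξ, y⟫`; the same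
formula with no linear term gives the normalising constant, so the two prefactors cancel. -/
lemma integral_gaussDensity_mul_cexp {d : ℕ} (m : E d) {v : ℝ} (hv : 0 < v) (ξ : E d) :
    ∫ y, (gaussDensity m v y : ℂ) * Complex.exp (inner ℝ y ξ * Complex.I) =
      Complex.exp (inner ℝ m ξ * Complex.I - v * ‖ξ‖ ^ 2 / 2) := by
  have hb : 0 < ((1 / (2 * v) : ℝ) : ℂ).re := by
    rw [Complex.ofReal_re]; positivity
  have h0 := GaussianFourier.integral_cexp_neg_mul_sq_norm_add hb 0 (0 : E d)
  have h1 := GaussianFourier.integral_cexp_neg_mul_sq_norm_add hb Complex.I ξ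
  have h2 : ∫ y : E d, Complex.exp (-((1 / (2 * v) : ℝ) : ℂ) * ‖y‖ ^ 2 + 0 * inner ℝ (0 : E d) y)
      = (((2 * Real.pi * v) ^ (d / 2 : ℝ) : ℝ) : ℂ) := by
    rw [← integral_exp_neg_norm_sq (d := d) hv, ← integral_complex_ofReal]
    congr 1; ext y; push_cast; congr 1; field_simp; simp
  rw [h2] at h0
  have h3 : ∀ y : E d, (gaussDensity m v (y + m) : ℂ) *
      Complex.exp (inner ℝ (y + m) ξ * Complex.I) =
      (((2 * Real.pi * v) ^ (-(d / 2 : ℝ)) : ℝ) : ℂ) * Complex.exp (inner ℝ m ξ * Complex.I) *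
      Complex.exp (-((1 / (2 * v) : ℝ) : ℂ) * ‖y‖ ^ 2 + Complex.I * inner ℝ ξ y) := by
    intro y
    unfold gaussDensity
    rw [add_sub_cancel_right, inner_add_left, real_inner_comm y ξ]
    push_cast
    rw [mul_assoc ((_ : ℝ) : ℂ), mul_assoc ((_ : ℝ) : ℂ), ← Complex.exp_add, ← Complex.exp_add]
    congr 2
    field_simp
    ring
  rw [← integral_add_right_eq_self _ m]
  simp_rw [h3]
  rw [integral_const_mul, h1]
  simp only [zero_pow two_ne_zero, zero_mul, zero_div, Complex.exp_zero, mul_one] at h0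
  rw [← h0]
  have h4 : (((2 * Real.pi * v) ^ (-(d / 2 : ℝ)) : ℝ) : ℂ) *
      (((2 * Real.pi * v) ^ (d / 2 : ℝ) : ℝ) : ℂ) = 1 := by
    rw [← Complex.ofReal_mul, ← Real.rpow_add (by positivity)]; simp
  rw [show ∀ A B C D : ℂ, A * B * (C * D) = (A * C) * (B * D) by intros; ring, h4, one_mul,
    ← Complex.exp_add]
  congr 1
  have : (v : ℂ) ≠ 0 := by exact_mod_cast hv.ne'
  push_cast
  simp only [Complex.I_sq]
  field_simp
  ring

lemma charFun_withDensity_gaussDensity {d : ℕ} (m : E d) {v : ℝ} (hv : 0 < v) (ξ : E d) :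
    charFun ((volume : Measure (E d)).withDensity
      (fun y ↦ ENNReal.ofReal (gaussDensity m v y))) ξ =
      Complex.exp (inner ℝ m ξ * Complex.I - v * ‖ξ‖ ^ 2 / 2) := by
  rw [charFun_apply, integral_withDensity_eq_integral_toReal_smul
    (by have := continuous_gaussDensity m v; fun_prop) (by simp),
    ← integral_gaussDensity_mul_cexp m hv ξ]
  congr 1; ext y
  rw [ENNReal.toReal_ofReal (gaussDensity_pos m hv y).le, Complex.real_smul]

lemma integrable_gaussDensity {d : ℕ} (m : E d) {v : ℝ} (hv : 0 < v) :
    Integrable (gaussDensity m v) := by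
  have hb : 0 < ((1 / (2 * v) : ℝ) : ℂ).re := by
    rw [Complex.ofReal_re]; positivity
  have h0 := (GaussianFourier.integrable_cexp_neg_mul_sq_norm_add hb 0 (0 : E d)).norm
  refine ((h0.comp_sub_right m).const_mul
    ((2 * Real.pi * v) ^ (-(d / 2 : ℝ)))).congr (.of_forall fun y ↦ ?_)
  unfold gaussDensity
  simp only [Complex.norm_exp]
  congr 2
  rw [← Complex.ofReal_pow, zero_mul, add_zero, ← Complex.ofReal_neg, ← Complex.ofReal_mul,
    Complex.ofReal_re]
  field_simp

lemma isFiniteMeasure_withDensity_gaussDensity {d : ℕ} (m : E d) {v : ℝ} (hv : 0 < v) :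
    IsFiniteMeasure ((volume : Measure (E d)).withDensity
      (fun y ↦ ENNReal.ofReal (gaussDensity m v y))) :=
  isFiniteMeasure_withDensity_ofReal (integrable_gaussDensity m hv).2

lemma multivariateGaussian_smul_one {d : ℕ} (m : E d) {v : ℝ} (hv : 0 < v) :
    multivariateGaussian m (v • (1 : Matrix (Fin d) (Fin d) ℝ)) =
      (volume : Measure (E d)).withDensity (fun y ↦ ENNReal.ofReal (gaussDensity m v y)) := by
  have := isFiniteMeasure_withDensity_gaussDensity m hv
  refine Measure.ext_of_charFun ?_
  ext ξ
  rw [charFun_withDensity_gaussDensity m hv, charFun_multivariateGaussian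
    (Matrix.PosSemidef.one.smul hv.le)]
  have h : ξ.ofLp ⬝ᵥ ξ.ofLp = ‖ξ‖ ^ 2 := by
    rw [EuclideanSpace.real_norm_sq_eq]; simp [dotProduct, sq]
  simp [Matrix.smul_mulVec, h, real_inner_comm]

/-! ### Weighted sums of Brownian increments -/

section BrownianMotion

variable {d : ℕ} {Ω : Type} {mΩ : MeasurableSpace Ω} {P : Measure Ω}
  {ℱ : Filtration ℝ≥0 mΩ} {W : ℝ≥0 → Ω → E d}

lemma IsBrownianMotion.isProbabilityMeasure (hW : IsBrownianMotion P ℱ W) :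
    IsProbabilityMeasure P := hW.indep_coord.isProbabilityMeasure

lemma IsBrownianMotion.measurable (hW : IsBrownianMotion P ℱ W) (t : ℝ≥0) : Measurable (W t) :=
  ((hW.adapted t).mono (ℱ.le t)).measurable

lemma IsBrownianMotion.charFun_increment (hW : IsBrownianMotion P ℱ W) {s t : ℝ≥0} (hst : s ≤ t)
    (ξ : E d) :
    charFun (P.map (fun ω ↦ W t ω - W s ω)) ξ =
      Complex.exp (-((((t : ℝ) - s) * ‖ξ‖ ^ 2 / 2 : ℝ) : ℂ)) := by
  have := hW.isProbabilityMeasure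
  have hind : iIndepFun (fun (i : Fin d) (ω : Ω) ↦ W t ω i - W s ω i) P :=
    hW.indep_coord.comp (fun _ w ↦ w t - w s) (fun _ ↦ by fun_prop)
  have hm : ∀ i, AEMeasurable (fun ω ↦ W t ω i - W s ω i) P := fun i ↦ by
    have h1 := hW.measurable t
    have h2 := hW.measurable s
    fun_prop
  have h := (iIndepFun_iff_charFun_pi hm).1 hind ξ
  have hD : (fun ω ↦ W t ω - W s ω) = fun ω ↦ WithLp.toLp 2 (fun i ↦ W t ω i - W s ω i) := by
    ext; simp
  rw [hD, h]
  have hi : ∀ i, charFun (P.map (fun ω ↦ W t ω i - W s ω i)) (ξ i) =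
      Complex.exp (-((((t : ℝ) - s) * ξ i ^ 2 / 2 : ℝ) : ℂ)) := by
    intro i
    have := (hW.coord i).toIsPreBrownianReal.hasLaw_sub t s
    have h' := this.map_eq
    simp only [Pi.sub_def] at h'
    rw [h', charFun_gaussianReal]
    congr 1
    have hn : ((nndist t.1 s.1 : ℝ≥0) : ℝ) = (t : ℝ) - s := by
      rw [coe_nndist, Real.dist_eq, abs_of_nonneg (sub_nonneg.2 (by exact_mod_cast hst))]; rfl
    rw [hn]; push_cast; ring
  rw [Finset.prod_congr rfl fun i _ ↦ hi i, ← Complex.exp_sum]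
  congr 1
  rw [EuclideanSpace.real_norm_sq_eq]
  push_cast
  rw [Finset.sum_neg_distrib, Finset.mul_sum, Finset.sum_div]

/-- By induction: the earlier increments are measurable for `ℱ (r n)`, of which the next increment
is independent, so its characteristic function enters as a factor and the variances add. -/
lemma IsBrownianMotion.charFun_sum_increments (hW : IsBrownianMotion P ℱ W) {r : ℕ → ℝ≥0}
    (hr : Monotone r) (c : ℕ → ℝ) (n : ℕ) (ξ : E d) :
    charFun (P.map (fun ω ↦ ∑ j ∈ Finset.range n, c j • (W (r (j + 1)) ω - W (r j) ω))) ξ =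
      Complex.exp (-(((∑ j ∈ Finset.range n, c j ^ 2 * ((r (j + 1) : ℝ) - r j)) *
        ‖ξ‖ ^ 2 / 2 : ℝ) : ℂ)) := by
  have := hW.isProbabilityMeasure
  induction n with
  | zero => simp
  | succ n ih =>
    simp_rw [Finset.sum_range_succ]
    have hS : Measurable[ℱ (r n)]
        (fun ω ↦ ∑ j ∈ Finset.range n, c j • (W (r (j + 1)) ω - W (r j) ω)) := by
      refine Finset.measurable_fun_sum _ fun j hj ↦ ?_
      have hj' := Finset.mem_range.1 hj
      have h1 := ((hW.adapted (r (j + 1))).mono (ℱ.mono (hr hj'))).measurable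
      have h2 := ((hW.adapted (r j)).mono (ℱ.mono (hr hj'.le))).measurable
      exact (h1.sub h2).const_smul (c j)
    have hD : Measurable (fun ω ↦ W (r (n + 1)) ω - W (r n) ω) :=
      (hW.measurable _).sub (hW.measurable _)
    have hS' := hS.mono (ℱ.le (r n)) le_rfl
    have hi : IndepFun (fun ω ↦ ∑ j ∈ Finset.range n, c j • (W (r (j + 1)) ω - W (r j) ω))
        (fun ω ↦ W (r (n + 1)) ω - W (r n) ω) P := by
      rw [IndepFun_iff_Indep]
      exact indep_of_indep_of_le_left (hW.indep_increment _ _ (hr n.le_succ)).symm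
        hS.comap_le
    have hi' : IndepFun (fun ω ↦ ∑ j ∈ Finset.range n, c j • (W (r (j + 1)) ω - W (r j) ω))
        (fun ω ↦ c n • (W (r (n + 1)) ω - W (r n) ω)) P :=
      hi.comp (φ := id) (ψ := fun x ↦ c n • x) measurable_id (measurable_const_smul (c n))
    have hD' : AEMeasurable (fun ω ↦ c n • (W (r (n + 1)) ω - W (r n) ω)) P :=
      (hD.const_smul (c n)).aemeasurable
    rw [IndepFun.charFun_map_fun_add_eq_mul hS'.aemeasurable hD' hi',
      Pi.mul_apply, ih, charFun_map_smul_comp hD.aemeasurable, hW.charFun_increment (hr n.le_succ),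
      ← Complex.exp_add]
    congr 1
    rw [norm_smul, mul_pow, Real.norm_eq_abs, sq_abs]
    push_cast
    ring

end BrownianMotion

/-! ### Passing to the limit in characteristic functions -/

lemma tendsto_integral_cexp_inner {d : ℕ} {Ω : Type} {mΩ : MeasurableSpace Ω} {P : Measure Ω}
    [IsFiniteMeasure P] {f : ℕ → Ω → E d} {g : Ω → E d} (hf : ∀ n, AEStronglyMeasurable (f n) P)
    (h : ∀ᵐ ω ∂P, Tendsto (fun n ↦ f n ω) atTop (𝓝 (g ω))) (ξ : E d) :
    Tendsto (fun n ↦ charFun (P.map (f n)) ξ) atTop (𝓝 (charFun (P.map g) ξ)) := by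
  have hg : AEStronglyMeasurable g P := aestronglyMeasurable_of_tendsto_ae _ hf h
  have key : ∀ f : Ω → E d, AEStronglyMeasurable f P →
      charFun (P.map f) ξ = ∫ ω, Complex.exp (inner ℝ (f ω) ξ * Complex.I) ∂P := fun f hf ↦ by
    rw [charFun_apply, integral_map hf.aemeasurable (by fun_prop)]
  rw [key g hg]
  simp_rw [fun n ↦ key (f n) (hf n)]
  refine tendsto_integral_of_dominated_convergence (fun _ ↦ 1) (fun n ↦ ?_) (integrable_const 1)
    (fun n ↦ .of_forall fun ω ↦ ?_) ?_
  · have := hf n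
    exact Continuous.comp_aestronglyMeasurable (g := fun x : E d ↦
      Complex.exp (inner ℝ x ξ * Complex.I)) (by fun_prop) this
  · rw [Complex.norm_exp_ofReal_mul_I]
  · filter_upwards [h] with ω hω
    have hc : Continuous (fun x : E d ↦ Complex.exp (inner ℝ x ξ * Complex.I)) := by fun_prop
    exact (hc.tendsto _).comp hω

/-- Convergence in probability yields almost sure convergence only along a subsequence; refining it
once per index gives one subsequence that serves finitely many limits, which may then be combined
linearly. -/
lemma exists_seq_tendsto_ae_finite {F : Type*} [PseudoEMetricSpace F] {Ω : Type*}
    {mΩ : MeasurableSpace Ω} {P : Measure Ω} {f : ℕ → ℕ → Ω → F} {g : ℕ → Ω → F} (n : ℕ)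
    (h : ∀ k < n, TendstoInMeasure P (f k) atTop (g k)) :
    ∃ ns : ℕ → ℕ, StrictMono ns ∧
      ∀ k < n, ∀ᵐ ω ∂P, Tendsto (fun i ↦ f k (ns i) ω) atTop (𝓝 (g k ω)) := by
  induction n with
  | zero => exact ⟨id, strictMono_id, by simp⟩
  | succ n ih =>
    obtain ⟨ns, hns, h1⟩ := ih fun k hk ↦ h k (by omega)
    obtain ⟨ms, hms, h2⟩ := ((h n (by omega)).comp hns.tendsto_atTop).exists_seq_tendsto_ae
    refine ⟨ns ∘ ms, hns.comp hms, fun k hk ↦ ?_⟩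
    rcases Nat.lt_succ_iff_lt_or_eq.1 hk with hk | rfl
    · filter_upwards [h1 k hk] with ω hω using hω.comp hms.tendsto_atTop
    · exact h2

/-! ### Riemann sums over uniform partitions -/

/-- The points of the uniform partition of `[s, t]` into `n` intervals. -/
noncomputable def grid (s t : ℝ) (n k : ℕ) : ℝ := s + k * ((t - s) / n)

@[simp] lemma grid_zero (s t : ℝ) (n : ℕ) : grid s t n 0 = s := by simp [grid]

lemma grid_self (s t : ℝ) {n : ℕ} (hn : n ≠ 0) : grid s t n n = t := by
  have : (n : ℝ) ≠ 0 := by exact_mod_cast hn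
  unfold grid; field_simp; ring

lemma grid_mono {s t : ℝ} (hst : s ≤ t) (n : ℕ) : Monotone (grid s t n) := fun i j hij ↦ by
  have : (i : ℝ) ≤ j := by exact_mod_cast hij
  have : 0 ≤ (t - s) / n := div_nonneg (sub_nonneg.2 hst) n.cast_nonneg
  unfold grid; gcongr

lemma grid_succ_sub (s t : ℝ) (n k : ℕ) : grid s t n (k + 1) - grid s t n k = (t - s) / n := by
  unfold grid; push_cast; ring

lemma le_grid {s t : ℝ} (hst : s ≤ t) (n k : ℕ) : s ≤ grid s t n k := by
  simpa using grid_mono hst n k.zero_le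

lemma grid_mem {s t : ℝ} (hst : s ≤ t) {n k : ℕ} (hn : n ≠ 0) (hk : k ≤ n) :
    grid s t n k ∈ Icc s t :=
  ⟨le_grid hst n k, by simpa [grid_self s t hn] using grid_mono hst n hk⟩

/-- Ensures that Itô sums with different upper endpoints can be taken over one common fine partition
of `[s, t]`, so that their differences are again sums of Brownian increments. -/
lemma grid_grid (s t : ℝ) {n k N : ℕ} (hk : k ≠ 0) (j : ℕ) :
    grid s (grid s t n k) (k * N) j = grid s t (n * N) j := by
  have : (k : ℝ) ≠ 0 := by exact_mod_cast hk
  unfold grid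
  push_cast
  rw [add_sub_cancel_left, mul_div_mul_left _ _ this, div_div]

lemma Icc_grid_subset {s t : ℝ} (hst : s ≤ t) {n k : ℕ} (hk : k < n) :
    Icc (grid s t n k) (grid s t n (k + 1)) ⊆ Icc s t :=
  Icc_subset_Icc (le_grid hst n k) (grid_mem hst (by omega) hk).2

lemma eventually_dist_le_of_mem_grid {F : Type*} [PseudoMetricSpace F] {f : ℝ → F} {s t : ℝ}
    (hst : s ≤ t) (hf : ContinuousOn f (Icc s t)) {ε : ℝ} (hε : 0 < ε) :
    ∀ᶠ n : ℕ in atTop, ∀ k < n, ∀ r ∈ Icc (grid s t n k) (grid s t n (k + 1)),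
      ∀ r' ∈ Icc (grid s t n k) (grid s t n (k + 1)), dist (f r) (f r') ≤ ε := by
  have hu := isCompact_Icc.uniformContinuousOn_of_continuous hf
  obtain ⟨δ, hδ, h⟩ := Metric.uniformContinuousOn_iff_le.1 hu ε hε
  have ht : Tendsto (fun n : ℕ ↦ (t - s) / n) atTop (𝓝 0) :=
    tendsto_const_div_atTop_nhds_zero_nat _
  filter_upwards [ht.eventually_le_const hδ] with n hn k hk r hr r' hr'
  refine h r (Icc_grid_subset hst hk hr) r' (Icc_grid_subset hst hk hr') ?_
  refine (Real.dist_le_of_mem_Icc hr hr').trans ?_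
  rwa [grid_succ_sub]

lemma norm_sum_integral_grid_le {F : Type*} [NormedAddCommGroup F] [NormedSpace ℝ F] {s t : ℝ}
    (hst : s ≤ t) (n : ℕ) {G : ℕ → ℝ → F} {C : ℝ} (hC : 0 ≤ C)
    (hG : ∀ k < n, ∀ r ∈ Icc (grid s t n k) (grid s t n (k + 1)), ‖G k r‖ ≤ C) :
    ‖∑ k ∈ Finset.range n, ∫ r in grid s t n k..grid s t n (k + 1), G k r‖ ≤ C * (t - s) := by
  calc _ ≤ ∑ k ∈ Finset.range n, C * ((t - s) / n) := by
        refine norm_sum_le_of_le _ fun k hk ↦ ?_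
        have hm := grid_mono hst n k.le_succ
        refine (intervalIntegral.norm_integral_le_of_norm_le_const (C := C) fun r hr ↦ ?_).trans ?_
        · rw [uIoc_of_le hm] at hr
          exact hG k (Finset.mem_range.1 hk) r (Ioc_subset_Icc_self hr)
        · rw [grid_succ_sub, abs_of_nonneg (div_nonneg (sub_nonneg.2 hst) n.cast_nonneg)]
    _ ≤ C * (t - s) := by
        rw [Finset.sum_const, Finset.card_range, nsmul_eq_mul]
        rcases eq_or_ne n 0 with rfl | hn
        · simpa using mul_nonneg hC (sub_nonneg.2 hst)
        · have : (n : ℝ) ≠ 0 := by exact_mod_cast hn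
          apply le_of_eq; field_simp

lemma intervalIntegrable_grid {F : Type*} [NormedAddCommGroup F] {s t : ℝ} (hst : s ≤ t)
    {f : ℝ → F} (hf : ContinuousOn f (Icc s t)) {n k : ℕ} (hk : k < n) :
    IntervalIntegrable f volume (grid s t n k) (grid s t n (k + 1)) := by
  refine ContinuousOn.intervalIntegrable (hf.mono ?_)
  rw [uIcc_of_le (grid_mono hst n k.le_succ)]
  exact Icc_grid_subset hst hk

lemma sum_integral_grid {F : Type*} [NormedAddCommGroup F] [NormedSpace ℝ F] {s t : ℝ}
    (hst : s ≤ t) {f : ℝ → F} (hf : ContinuousOn f (Icc s t)) {n : ℕ} (hn : n ≠ 0) :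
    ∑ k ∈ Finset.range n, ∫ r in grid s t n k..grid s t n (k + 1), f r = ∫ r in s..t, f r := by
  rw [intervalIntegral.sum_integral_adjacent_intervals (a := grid s t n)
    fun k hk ↦ intervalIntegrable_grid hst hf hk, grid_zero, grid_self s t hn]

/-- Freezing `f` at the left endpoint costs at most its oscillation on one cell, which is uniformly
small. Such mixed sums are the variances of Wiener integrals of step functions. -/
lemma tendsto_sum_mul_integral_grid {f g : ℝ → ℝ} {s t : ℝ} (hst : s ≤ t)
    (hf : ContinuousOn f (Icc s t)) (hg : ContinuousOn g (Icc s t)) :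
    Tendsto (fun n ↦ ∑ k ∈ Finset.range n,
      f (grid s t n k) * ∫ r in grid s t n k..grid s t n (k + 1), g r) atTop
      (𝓝 (∫ r in s..t, f r * g r)) := by
  obtain ⟨C, hC⟩ := isCompact_Icc.exists_bound_of_continuousOn hg
  have hC0 : 0 ≤ C := (norm_nonneg _).trans (hC s (left_mem_Icc.2 hst))
  rw [Metric.tendsto_atTop']
  intro ε hε
  obtain ⟨η, hη, hηε⟩ : ∃ η > 0, η * C * (t - s) < ε := by
    have h0 : 0 ≤ C * (t - s) := mul_nonneg hC0 (sub_nonneg.2 hst)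
    refine ⟨ε / (C * (t - s) + 1), by positivity, ?_⟩
    rw [mul_assoc, div_mul_eq_mul_div, div_lt_iff₀ (by positivity)]
    nlinarith
  obtain ⟨N, hN⟩ := eventually_atTop.1 (eventually_dist_le_of_mem_grid hst hf hη)
  refine ⟨N, fun n hn ↦ ?_⟩
  have hn0 : n ≠ 0 := by omega
  rw [← sum_integral_grid hst (f := fun r ↦ f r * g r) (hf.mul hg) hn0, dist_eq_norm,
    ← Finset.sum_sub_distrib]
  have he : ∀ k ∈ Finset.range n, (f (grid s t n k) * ∫ r in grid s t n k..grid s t n (k + 1), g r)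
      - ∫ r in grid s t n k..grid s t n (k + 1), f r * g r =
      ∫ r in grid s t n k..grid s t n (k + 1), (f (grid s t n k) - f r) * g r := by
    intro k hk
    have hk := Finset.mem_range.1 hk
    rw [← intervalIntegral.integral_const_mul, ← intervalIntegral.integral_sub
      ((intervalIntegrable_grid hst hg hk).const_mul _)
      (intervalIntegrable_grid hst (f := fun r ↦ f r * g r) (hf.mul hg) hk)]
    simp_rw [sub_mul]
  rw [Finset.sum_congr rfl he]
  refine (norm_sum_integral_grid_le hst n (mul_nonneg hη.le hC0) fun k hk r hr ↦ ?_).trans_lt hηε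
  rw [norm_mul]
  refine mul_le_mul ?_ (hC r (Icc_grid_subset hst hk hr)) (norm_nonneg _) hη.le
  rw [← dist_eq_norm]
  exact hN n hn.le k hk _ (left_mem_Icc.2 (grid_mono hst n k.le_succ)) _ hr

lemma tendsto_riemannSum {f : ℝ → ℝ} {s t : ℝ} (hst : s ≤ t) (hf : ContinuousOn f (Icc s t)) :
    Tendsto (fun n ↦ ∑ k ∈ Finset.range n,
      f (grid s t n k) * (grid s t n (k + 1) - grid s t n k)) atTop (𝓝 (∫ r in s..t, f r)) := by
  simpa using tendsto_sum_mul_integral_grid hst hf (continuousOn_const (c := (1 : ℝ)))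

/-! ### Variation of constants along a path -/

/-- `exp (-∫_r^t b)`, the factor by which `x' = -b x` contracts from time `r` to time `t`. -/
noncomputable def decay (b : ℝ → ℝ) (t r : ℝ) : ℝ := Real.exp (-∫ u in r..t, b u)

@[simp] lemma decay_self (b : ℝ → ℝ) (t : ℝ) : decay b t t = 1 := by simp [decay]

lemma hasDerivAt_decay {b : ℝ → ℝ} (hb : Continuous b) (t r : ℝ) :
    HasDerivAt (decay b t) (b r * decay b t r) r := by
  have h := intervalIntegral.integral_hasDerivAt_left (hb.intervalIntegrable r t)
    (hb.stronglyMeasurableAtFilter _ _) hb.continuousAt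
  have h' : HasDerivAt (fun u ↦ -∫ x in u..t, b x) (b r) r := by
    have := h.neg
    rwa [neg_neg] at this
  rw [mul_comm]
  exact h'.exp

lemma continuous_decay {b : ℝ → ℝ} (hb : Continuous b) (t : ℝ) : Continuous (decay b t) :=
  continuous_iff_continuousAt.2 fun r ↦ (hasDerivAt_decay hb t r).continuousAt

/-- Variation of constants for `X = x + M - ∫ b X`, by Riemann sums for `∫ decay dM`. -/
lemma tendsto_sum_decay_smul {F : Type*} [NormedAddCommGroup F] [NormedSpace ℝ F]
    [CompleteSpace F] {b : ℝ → ℝ} (hb : Continuous b) {s t : ℝ} (hst : s ≤ t) {X M : ℝ → F}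
    (hX : ContinuousOn X (Icc s t)) (x : F)
    (hM : ∀ r ∈ Icc s t, M r = X r - x + ∫ u in s..r, b u • X u) :
    Tendsto (fun n ↦ ∑ k ∈ Finset.range n,
      decay b t (grid s t n k) • (M (grid s t n (k + 1)) - M (grid s t n k))) atTop
      (𝓝 (X t - decay b t s • X s)) := by
  have hφ := continuous_decay hb t
  obtain ⟨A, hA⟩ := isCompact_Icc.exists_bound_of_continuousOn (hb.continuousOn (s := Icc s t))
  obtain ⟨B, hB⟩ := isCompact_Icc.exists_bound_of_continuousOn (hφ.continuousOn (s := Icc s t))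
  obtain ⟨C, hC⟩ := isCompact_Icc.exists_bound_of_continuousOn hX
  have hs := left_mem_Icc.2 hst
  have hA0 : 0 ≤ A := (norm_nonneg _).trans (hA s hs)
  have hB0 : 0 ≤ B := (norm_nonneg _).trans (hB s hs)
  have hC0 : 0 ≤ C := (norm_nonneg _).trans (hC s hs)
  have hbX : ContinuousOn (fun u ↦ b u • X u) (Icc s t) := hb.continuousOn.smul hX
  rw [Metric.tendsto_atTop']
  intro ε hε
  -- The left side is the total error when `X` and the decay factor oscillate by at most `η` on each
  -- cell.
  obtain ⟨η, hη, hηε⟩ : ∃ η > 0, A * (B * η + η * C) * (t - s) < ε := by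
    have h0 : 0 ≤ A * (B + C) * (t - s) :=
      mul_nonneg (mul_nonneg hA0 (add_nonneg hB0 hC0)) (sub_nonneg.2 hst)
    refine ⟨ε / (A * (B + C) * (t - s) + 1), by positivity, ?_⟩
    rw [show ∀ η : ℝ, A * (B * η + η * C) * (t - s) = η * (A * (B + C) * (t - s)) by
      intro η; ring, div_mul_eq_mul_div, div_lt_iff₀ (by positivity)]
    nlinarith
  obtain ⟨N, hN⟩ := eventually_atTop.1 ((eventually_dist_le_of_mem_grid hst hX hη).and
    (eventually_dist_le_of_mem_grid hst (hφ.continuousOn (s := Icc s t)) hη))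
  refine ⟨N, fun n hn ↦ ?_⟩
  have hn0 : n ≠ 0 := by omega
  have htel : X t - decay b t s • X s = ∑ k ∈ Finset.range n,
      (decay b t (grid s t n (k + 1)) • X (grid s t n (k + 1)) -
        decay b t (grid s t n k) • X (grid s t n k)) := by
    rw [Finset.sum_range_sub (fun k ↦ decay b t (grid s t n k) • X (grid s t n k)),
      grid_self s t hn0]
    simp
  rw [dist_comm, dist_eq_norm, htel, ← Finset.sum_sub_distrib]
  -- The product rule on one cell: the derivative of the decay factor nearly cancels the drift in
  -- `M`. What remains compares `decay b t r • X` at the right endpoint with the left-endpoint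
  -- factor times `X r`, and is small by uniform continuity.
  have he : ∀ k ∈ Finset.range n,
      (decay b t (grid s t n (k + 1)) • X (grid s t n (k + 1)) -
        decay b t (grid s t n k) • X (grid s t n k)) -
      decay b t (grid s t n k) • (M (grid s t n (k + 1)) - M (grid s t n k)) =
      ∫ r in grid s t n k..grid s t n (k + 1),
        b r • (decay b t r • X (grid s t n (k + 1)) - decay b t (grid s t n k) • X r) := by
    intro k hk
    have hk := Finset.mem_range.1 hk
    have hm := grid_mono hst n k.le_succ
    have hsub : ∀ i ≤ n, IntervalIntegrable (fun u ↦ b u • X u) volume s (grid s t n i) :=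
      fun i hi ↦ (hbX.mono (by
        rw [uIcc_of_le (le_grid hst n i)]
        exact Icc_subset_Icc_right (grid_mem hst hn0 hi).2)).intervalIntegrable
    have h1 : ∫ r in grid s t n k..grid s t n (k + 1), b r * decay b t r =
        decay b t (grid s t n (k + 1)) - decay b t (grid s t n k) :=
      intervalIntegral.integral_eq_sub_of_hasDerivAt (fun r _ ↦ hasDerivAt_decay hb t r)
        ((hb.mul hφ).intervalIntegrable _ _)
    have h2 := intervalIntegral.integral_interval_sub_left (hsub (k + 1) hk) (hsub k hk.le)
    have h3 : ∀ r, b r • (decay b t r • X (grid s t n (k + 1)) - decay b t (grid s t n k) • X r) =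
        (b r * decay b t r) • X (grid s t n (k + 1)) - decay b t (grid s t n k) • (b r • X r) :=
      fun r ↦ by rw [smul_sub, smul_smul, smul_comm (b r)]
    simp_rw [h3]
    have h5 : IntervalIntegrable (fun r ↦ (b r * decay b t r) • X (grid s t n (k + 1))) volume
        (grid s t n k) (grid s t n (k + 1)) :=
      ((hb.mul hφ).smul continuous_const).intervalIntegrable _ _
    have h6 : IntervalIntegrable (fun r ↦ decay b t (grid s t n k) • b r • X r) volume
        (grid s t n k) (grid s t n (k + 1)) :=
      (intervalIntegrable_grid hst hbX hk).smul _
    rw [intervalIntegral.integral_sub h5 h6, intervalIntegral.integral_smul_const,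
      intervalIntegral.integral_smul, h1, ← h2, hM _ (grid_mem hst hn0 hk),
      hM _ (grid_mem hst hn0 hk.le)]
    module
  rw [Finset.sum_congr rfl he]
  refine (norm_sum_integral_grid_le hst n (by positivity) fun k hk r hr ↦ ?_).trans_lt hηε
  have hr' := Icc_grid_subset hst hk hr
  have hm := grid_mono hst n k.le_succ
  rw [norm_smul]
  refine mul_le_mul (hA r hr') ?_ (norm_nonneg _) hA0
  have h4 : decay b t r • X (grid s t n (k + 1)) - decay b t (grid s t n k) • X r =
      decay b t r • (X (grid s t n (k + 1)) - X r) +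
        (decay b t r - decay b t (grid s t n k)) • X r := by module
  rw [h4]
  refine (norm_add_le _ _).trans ?_
  rw [norm_smul, norm_smul]
  gcongr
  · exact hB r hr'
  · rw [← dist_eq_norm]
    exact (hN n hn.le).1 k hk _ (right_mem_Icc.2 hm) _ hr
  · rw [← dist_eq_norm]
    exact (hN n hn.le).2 k hk _ hr _ (left_mem_Icc.2 hm)
  · exact hC r hr'

/-! ### Wiener integrals of step functions -/

/-- Summation over blocks of length `N`. -/
lemma sum_smul_block {R F : Type*} [Ring R] [AddCommGroup F] [Module R F] (c : ℕ → R)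
    (a : ℕ → F) {N : ℕ} (hN : 0 < N) (n : ℕ) :
    ∑ k ∈ Finset.range n, c k • (∑ j ∈ Finset.range ((k + 1) * N), a j -
      ∑ j ∈ Finset.range (k * N), a j) = ∑ j ∈ Finset.range (n * N), c (j / N) • a j := by
  induction n with
  | zero => simp
  | succ n ih =>
    rw [Finset.sum_range_succ, ih, add_mul, one_mul, Finset.sum_range_add, Finset.sum_range_add,
      add_sub_cancel_left, Finset.smul_sum]
    congr 1
    refine Finset.sum_congr rfl fun j hj ↦ ?_
    rw [mul_comm n N, Nat.mul_add_div hN, Nat.div_eq_of_lt (Finset.mem_range.1 hj), add_zero]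

section WienerIntegral

variable {d : ℕ} {Ω : Type} {mΩ : MeasurableSpace Ω} {P : Measure Ω}
  {ℱ : Filtration ℝ≥0 mΩ} {W : ℝ≥0 → Ω → E d}

lemma itoSum_eq_sum_grid (σ : ℝ → ℝ) (W : ℝ≥0 → Ω → E d) (s t : ℝ) (n : ℕ) (ω : Ω) :
    itoSum σ W s t n ω = ∑ k ∈ Finset.range n, σ (grid s t n k) •
      (W (grid s t n (k + 1)).toNNReal ω - W (grid s t n k).toNNReal ω) := by
  simp [itoSum, grid]

lemma itoSum_self (σ : ℝ → ℝ) (W : ℝ≥0 → Ω → E d) (s : ℝ) (n : ℕ) : itoSum σ W s s n = 0 := by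
  ext ω; simp [itoSum]

lemma itoSum_grid (σ : ℝ → ℝ) (W : ℝ≥0 → Ω → E d) (s t : ℝ) (n k N : ℕ) (ω : Ω) :
    itoSum σ W s (grid s t n k) (k * N) ω = ∑ j ∈ Finset.range (k * N), σ (grid s t (n * N) j) •
      (W (grid s t (n * N) (j + 1)).toNNReal ω - W (grid s t (n * N) j).toNNReal ω) := by
  rw [itoSum_eq_sum_grid]
  rcases eq_or_ne k 0 with rfl | hk
  · simp
  · simp_rw [grid_grid s t hk]

/-- Each increment of `M` is a limit of Itô sums. Cutting every coarse cell into `N` pieces makes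
the approximation a weighted sum of independent increments, whose variance is a Riemann sum for the
claimed one. Only `σ ^ 2` enters, so continuity is asked of `γ` alone. -/
lemma charFun_sum_smul_wiener (hW : IsBrownianMotion P ℱ W) {σ γ : ℝ → ℝ} {s t : ℝ} (hs : 0 ≤ s)
    (hst : s ≤ t) (hγ : ContinuousOn γ (Icc s t)) (hσ : ∀ r ∈ Icc s t, σ r ^ 2 = γ r)
    {M : ℝ → Ω → E d}
    (hM : ∀ r ∈ Icc s t, TendstoInMeasure P (itoSum σ W s r) atTop (M r)) (c : ℕ → ℝ)
    {n : ℕ} (hn : n ≠ 0) (ξ : E d) :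
    AEStronglyMeasurable (fun ω ↦ ∑ k ∈ Finset.range n, c k •
        (M (grid s t n (k + 1)) ω - M (grid s t n k) ω)) P ∧
    charFun (P.map (fun ω ↦ ∑ k ∈ Finset.range n, c k •
        (M (grid s t n (k + 1)) ω - M (grid s t n k) ω))) ξ =
      Complex.exp (-(((∑ k ∈ Finset.range n, c k ^ 2 *
        ∫ r in grid s t n k..grid s t n (k + 1), γ r) * ‖ξ‖ ^ 2 / 2 : ℝ) : ℂ)) := by
  have := hW.isProbabilityMeasure
  have hlim : ∀ k < n + 1, TendstoInMeasure P
      (fun N ↦ itoSum σ W s (grid s t n k) (k * N)) atTop (M (grid s t n k)) := by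
    intro k hk
    -- For `k = 0` the number of pieces `k * N` does not tend to infinity, but every Itô sum over
    -- `[s, s]` is zero anyway.
    rcases Nat.eq_zero_or_pos k with rfl | hk0
    · have h0 : itoSum σ W s s = fun _ _ ↦ 0 := funext (itoSum_self σ W s)
      simpa [itoSum_self, Pi.zero_def, h0] using hM s (left_mem_Icc.2 hst)
    · exact (hM _ (grid_mem hst hn (by omega))).comp
        (tendsto_id.const_mul_atTop' hk0)
  obtain ⟨ns, hns, hae⟩ := exists_seq_tendsto_ae_finite (n + 1) hlim
  let r : ℕ → ℕ → ℝ≥0 := fun N j ↦ (grid s t (n * N) j).toNNReal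
  have hr : ∀ N, Monotone (r N) := fun N i j hij ↦
    Real.toNNReal_mono (grid_mono hst (n * N) hij)
  have hr' : ∀ N j, (r N j : ℝ) = grid s t (n * N) j := fun N j ↦
    Real.coe_toNNReal _ (hs.trans (le_grid hst _ _))
  let J : ℕ → Ω → E d := fun N ω ↦ ∑ k ∈ Finset.range n, c k •
    (itoSum σ W s (grid s t n (k + 1)) ((k + 1) * N) ω - itoSum σ W s (grid s t n k) (k * N) ω)
  -- The fine cell `j` lies in the coarse cell `j / N`, whose coefficient it inherits.
  have hJ : ∀ N, 0 < N → J N = fun ω ↦ ∑ j ∈ Finset.range (n * N),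
      (c (j / N) * σ (grid s t (n * N) j)) • (W (r N (j + 1)) ω - W (r N j) ω) := by
    intro N hN
    ext1 ω
    simp only [J, itoSum_grid]
    rw [sum_smul_block _ _ hN]
    simp_rw [smul_smul]
    rfl
  have hJm : ∀ N, AEStronglyMeasurable (J N) P := by
    intro N
    have := hW.measurable
    refine Measurable.aestronglyMeasurable ?_
    simp only [J, itoSum_grid]
    fun_prop
  have hJae : ∀ᵐ ω ∂P, Tendsto (fun i ↦ J (ns i) ω) atTop (𝓝 (∑ k ∈ Finset.range n, c k •
        (M (grid s t n (k + 1)) ω - M (grid s t n k) ω))) := by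
    have h : ∀ᵐ ω ∂P, ∀ k ∈ Finset.range (n + 1), Tendsto
        (fun i ↦ itoSum σ W s (grid s t n k) (k * ns i) ω) atTop (𝓝 (M (grid s t n k) ω)) :=
      (Finset.eventually_all _).2 fun k hk ↦ hae k (Finset.mem_range.1 hk)
    filter_upwards [h] with ω hω
    refine tendsto_finsetSum _ fun k hk ↦ ?_
    have hk := Finset.mem_range.1 hk
    exact ((hω (k + 1) (by simp; omega)).sub (hω k (by simp; omega))).const_smul _
  refine ⟨aestronglyMeasurable_of_tendsto_ae _ (fun i ↦ hJm (ns i)) hJae, ?_⟩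
  refine tendsto_nhds_unique (tendsto_integral_cexp_inner (fun i ↦ hJm (ns i)) hJae ξ) ?_
  let R : ℕ → ℕ → ℝ := fun N k ↦ ∑ j ∈ Finset.range (k * N),
    γ (grid s t (n * N) j) * (grid s t (n * N) (j + 1) - grid s t (n * N) j)
  have hR : ∀ k ≤ n, Tendsto (fun N ↦ R N k) atTop (𝓝 (∫ u in s..grid s t n k, γ u)) := by
    intro k hk
    rcases Nat.eq_zero_or_pos k with rfl | hk0
    · simp [R]
    · have := (tendsto_riemannSum (le_grid hst n k) (hγ.mono
        (Icc_subset_Icc_right (grid_mem hst hn hk).2))).comp (tendsto_id.const_mul_atTop' hk0)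
      refine this.congr fun N ↦ ?_
      simp only [Function.comp, id, R, grid_grid s t hk0.ne']
  have hV : Tendsto (fun N ↦ ∑ k ∈ Finset.range n, c k ^ 2 * (R N (k + 1) - R N k)) atTop
      (𝓝 (∑ k ∈ Finset.range n, c k ^ 2 *
        ∫ r in grid s t n k..grid s t n (k + 1), γ r)) := by
    refine tendsto_finsetSum _ fun k hk ↦ ?_
    have hk := Finset.mem_range.1 hk
    have hi : ∀ i ≤ n, IntervalIntegrable γ volume s (grid s t n i) := fun i hi ↦ by
      refine (hγ.mono ?_).intervalIntegrable
      rw [uIcc_of_le (le_grid hst n i)]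
      exact Icc_subset_Icc_right (grid_mem hst hn hi).2
    rw [← intervalIntegral.integral_interval_sub_left (hi (k + 1) hk) (hi k hk.le)]
    exact ((hR (k + 1) hk).sub (hR k hk.le)).const_mul _
  have hchar : ∀ N, 0 < N → charFun (P.map (J N)) ξ = Complex.exp (-(((∑ k ∈ Finset.range n,
      c k ^ 2 * (R N (k + 1) - R N k)) * ‖ξ‖ ^ 2 / 2 : ℝ) : ℂ)) := by
    intro N hN
    rw [hJ N hN, hW.charFun_sum_increments (hr N)]
    have hb := sum_smul_block (fun k ↦ c k ^ 2) (fun j ↦ γ (grid s t (n * N) j) *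
      (grid s t (n * N) (j + 1) - grid s t (n * N) j)) hN n
    simp only [smul_eq_mul] at hb
    rw [hb]
    congr 5
    refine Finset.sum_congr rfl fun j hj ↦ ?_
    rw [mul_pow, hσ _ (grid_mem hst (by positivity) (Finset.mem_range.1 hj).le), hr', hr',
      mul_assoc]
  have hc : Continuous fun V : ℝ ↦ Complex.exp (-((V * ‖ξ‖ ^ 2 / 2 : ℝ) : ℂ)) := by fun_prop
  refine Tendsto.congr' ?_ (((hc.tendsto _).comp hV).comp hns.tendsto_atTop)
  filter_upwards [eventually_gt_atTop 0] with i hi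
  -- A strictly increasing sequence satisfies `i ≤ ns i`, so `0 < ns i` as the block length
  -- requires.
  exact (hchar (ns i) (hi.trans_le (hns.id_le i))).symm

end WienerIntegral

/-! ### The law of a linear SDE and its transition density -/

section LinearDrift

variable {d : ℕ} {Ω : Type} {mΩ : MeasurableSpace Ω} {P : Measure Ω}
  {ℱ : Filtration ℝ≥0 mΩ} {W : ℝ≥0 → Ω → E d} {B : E d → ℝ → E d} {b σ γ : ℝ → ℝ} {s t : ℝ}
  {x : E d} {X : ℝ → Ω → E d}

/-- The initial condition is hidden in the equation at time `s`, where the Itô sums vanish and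
limits in probability are unique. -/
lemma IsSDESolution.initial (hX : IsSDESolution P ℱ W B σ s x X) (hs : s ≤ 1) :
    ∀ᵐ ω ∂P, X s ω = x := by
  have h := hX.equation s (left_mem_Icc.2 hs)
  have h' : TendstoInMeasure P (itoSum σ W s s) atTop (0 : Ω → E d) := by
    refine fun ε hε ↦ ?_
    simp [itoSum_self, hε.ne']
  filter_upwards [tendstoInMeasure_ae_unique h h'] with ω hω
  simpa [sub_eq_zero] using hω

/-- The sums of the decay factor against increments of `M` converge along almost every path to `X t
- decay b t s • x`, and their characteristic functions are known. Since the limit is taken pathwise,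
no stochastic product rule is needed. -/
lemma IsSDESolution.charFun_map (hW : IsBrownianMotion P ℱ W)
    (hX : IsSDESolution P ℱ W B σ s x X) (hb : Continuous b)
    (hB : ∀ y, ∀ r ∈ Icc s 1, B y r = -(b r • y)) (hγ : ContinuousOn γ (Icc s 1))
    (hσ : ∀ r ∈ Icc s 1, σ r ^ 2 = γ r) (hs : 0 ≤ s) (hst : s < t) (ht : t ≤ 1) (ξ : E d) :
    charFun (P.map (X t)) ξ = Complex.exp (inner ℝ (decay b t s • x) ξ * Complex.I -
      ((∫ r in s..t, decay b t r ^ 2 * γ r : ℝ) : ℂ) * ‖ξ‖ ^ 2 / 2) := by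
  have := hW.isProbabilityMeasure
  have hsub : Icc s t ⊆ Icc s 1 := Icc_subset_Icc_right ht
  let M : ℝ → Ω → E d := fun r ω ↦ X r ω - x - ∫ u in s..r, B (X u ω) u
  have hM : ∀ r ∈ Icc s t, TendstoInMeasure P (itoSum σ W s r) atTop (M r) :=
    fun r hr ↦ hX.equation r (hsub hr)
  -- The shift to `n + 1` excludes the empty partition.
  let S : ℕ → Ω → E d := fun n ω ↦ ∑ k ∈ Finset.range (n + 1), decay b t (grid s t (n + 1) k) •
    (M (grid s t (n + 1) (k + 1)) ω - M (grid s t (n + 1) k) ω)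
  have hS := fun n ↦ charFun_sum_smul_wiener hW hs hst.le (hγ.mono hsub)
    (fun r hr ↦ hσ r (hsub hr)) hM (fun k ↦ decay b t (grid s t (n + 1) k)) (n.succ_ne_zero) ξ
  have hae : ∀ᵐ ω ∂P, Tendsto (fun n ↦ S n ω) atTop (𝓝 (X t ω - decay b t s • x)) := by
    filter_upwards [hX.continuous_paths, hX.initial (hst.le.trans ht)] with ω hc h0
    have h := tendsto_sum_decay_smul hb hst.le (X := fun r ↦ X r ω) (M := fun r ↦ M r ω)
      (hc.mono hsub) x (fun r hr ↦ by
        have hI : ∫ u in s..r, B (X u ω) u = -∫ u in s..r, b u • X u ω := by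
          rw [← intervalIntegral.integral_neg]
          refine intervalIntegral.integral_congr fun u hu ↦ ?_
          rw [uIcc_of_le hr.1] at hu
          exact hB _ u ⟨hu.1, hu.2.trans (hr.2.trans ht)⟩
        simp only [M]
        rw [hI, sub_neg_eq_add])
    rw [h0] at h
    exact h.comp (tendsto_add_atTop_nat 1)
  have h1 := tendsto_integral_cexp_inner (fun n ↦ (hS n).1) hae ξ
  have hφ := continuous_decay hb t
  have hV := (tendsto_sum_mul_integral_grid hst.le (f := fun r ↦ decay b t r ^ 2)
    (hφ.pow 2).continuousOn (hγ.mono hsub)).comp (tendsto_add_atTop_nat 1)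
  have hc : Continuous fun V : ℝ ↦ Complex.exp (-((V * ‖ξ‖ ^ 2 / 2 : ℝ) : ℂ)) := by fun_prop
  have h2 := tendsto_nhds_unique h1
    (((hc.tendsto _).comp hV).congr fun n ↦ ((hS n).2).symm)
  have hXm : AEMeasurable (X t) P :=
    ((hX.adapted t ⟨hst.le, ht⟩).mono (ℱ.le _)).measurable.aemeasurable
  have h3 : charFun (P.map (fun ω ↦ (X t ω - decay b t s • x) + decay b t s • x)) ξ =
      charFun ((P.map (fun ω ↦ X t ω - decay b t s • x)).map (fun y ↦ y + decay b t s • x)) ξ := by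
    rw [AEMeasurable.map_map_of_aemeasurable (by fun_prop) (by fun_prop)]
    rfl
  simp only [sub_add_cancel] at h3
  rw [h3, charFun_map_add_const, h2, ← Complex.exp_add]
  congr 1
  push_cast
  ring

lemma IsSDESolution.map_eq (hW : IsBrownianMotion P ℱ W)
    (hX : IsSDESolution P ℱ W B σ s x X) (hb : Continuous b)
    (hB : ∀ y, ∀ r ∈ Icc s 1, B y r = -(b r • y)) (hγ : ContinuousOn γ (Icc s 1))
    (hσ : ∀ r ∈ Icc s 1, σ r ^ 2 = γ r) (hs : 0 ≤ s) (hst : s < t) (ht : t ≤ 1)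
    (hv : 0 < ∫ r in s..t, decay b t r ^ 2 * γ r) :
    P.map (X t) = (volume : Measure (E d)).withDensity (fun y ↦ ENNReal.ofReal
      (gaussDensity (decay b t s • x) (∫ r in s..t, decay b t r ^ 2 * γ r) y)) := by
  have := hW.isProbabilityMeasure
  have := isFiniteMeasure_withDensity_gaussDensity (decay b t s • x) hv
  refine Measure.ext_of_charFun ?_
  ext ξ
  rw [charFun_withDensity_gaussDensity _ hv, hX.charFun_map hW hb hB hγ hσ hs hst ht]

lemma IsTransitionDensity.eq_gaussDensity {q : ℝ → E d → ℝ → E d → ℝ}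
    (hq : IsTransitionDensity B σ q) (hb : Continuous b)
    (hB : ∀ y, ∀ r ∈ Icc (0 : ℝ) 1, B y r = -(b r • y)) (hγ : ContinuousOn γ (Icc 0 1))
    (hσ : ∀ r ∈ Icc (0 : ℝ) 1, σ r ^ 2 = γ r) (hs : 0 ≤ s) (hst : s < t) (ht : t ≤ 1)
    (hv : 0 < ∫ r in s..t, decay b t r ^ 2 * γ r) (x y : E d) :
    q s x t y = gaussDensity (decay b t s • x) (∫ r in s..t, decay b t r ^ 2 * γ r) y := by
  obtain ⟨Ω, mΩ, P, ℱ, W, X, hW, hX, hlaw⟩ := hq.law s hs (hst.trans_le ht) x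
  have hsub : Icc s 1 ⊆ Icc 0 1 := Icc_subset_Icc_left hs
  have h := (hlaw t hst ht).symm.trans (hX.map_eq hW hb (fun y r hr ↦ hB y r (hsub hr))
    (hγ.mono hsub) (fun r hr ↦ hσ r (hsub hr)) hs hst ht hv)
  have hqc := hq.continuous s t hs hst ht x
  have hgc := continuous_gaussDensity (decay b t s • x) (∫ r in s..t, decay b t r ^ 2 * γ r)
  have hae := (withDensity_eq_iff_of_sigmaFinite (by fun_prop) (by fun_prop)).1 h
  have heq := Continuous.ae_eq_iff_eq volume (ENNReal.continuous_ofReal.comp hqc)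
    (ENNReal.continuous_ofReal.comp hgc) |>.1 hae
  exact (ENNReal.ofReal_eq_ofReal_iff (hq.nonneg s t hs hst ht x y)
    (gaussDensity_pos _ hv y).le).1 (congrFun heq y)

end LinearDrift

/-! ### Bias and variance -/

section BiasVariance

variable {Ω F : Type*} {mΩ : MeasurableSpace Ω} {μ : Measure Ω} [NormedAddCommGroup F]
  [InnerProductSpace ℝ F] [CompleteSpace F]

/-- Bias-variance decomposition for a weighted mean. -/
lemma lintegral_mul_enorm_sub_sq {k : Ω → ℝ} {y : Ω → F} (hk0 : ∀ ω, 0 ≤ k ω)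
    (hk : Integrable k μ) (hky : Integrable (fun ω ↦ k ω • y ω) μ)
    (hky2 : Integrable (fun ω ↦ k ω * ‖y ω‖ ^ 2) μ) (hZ : 0 < ∫ ω, k ω ∂μ) (v : F) :
    ∫⁻ ω, ENNReal.ofReal (k ω) * ‖y ω - v‖ₑ ^ 2 ∂μ =
      ∫⁻ ω, ENNReal.ofReal (k ω) * ‖y ω - (∫ ω, k ω ∂μ)⁻¹ • ∫ ω, k ω • y ω ∂μ‖ₑ ^ 2 ∂μ +
      ENNReal.ofReal (∫ ω, k ω ∂μ) * ‖v - (∫ ω, k ω ∂μ)⁻¹ • ∫ ω, k ω • y ω ∂μ‖ₑ ^ 2 := by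
  have hexp : ∀ (u : F) (ω : Ω), k ω * ‖y ω - u‖ ^ 2 =
      k ω * ‖y ω‖ ^ 2 - 2 * inner ℝ u (k ω • y ω) + ‖u‖ ^ 2 * k ω := fun u ω ↦ by
    rw [norm_sub_sq_real, inner_smul_right, real_inner_comm u]; ring
  have hin : ∀ u : F, Integrable (fun ω ↦ inner ℝ u (k ω • y ω)) μ := fun u ↦ hky.const_inner u
  have hint : ∀ u : F, Integrable (fun ω ↦ k ω * ‖y ω - u‖ ^ 2) μ := fun u ↦ by
    simp_rw [hexp]
    exact (hky2.sub ((hin u).const_mul 2)).add (hk.const_mul _)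
  have hl : ∀ u : F, ∫⁻ ω, ENNReal.ofReal (k ω) * ‖y ω - u‖ₑ ^ 2 ∂μ =
      ENNReal.ofReal (∫ ω, k ω * ‖y ω - u‖ ^ 2 ∂μ) := fun u ↦ by
    rw [ofReal_integral_eq_lintegral_ofReal (hint u)
      (.of_forall fun ω ↦ mul_nonneg (hk0 ω) (sq_nonneg _))]
    congr with ω
    rw [ENNReal.ofReal_mul (hk0 ω), ENNReal.ofReal_pow (norm_nonneg _), ofReal_norm]
  have hi : ∀ u : F, ∫ ω, k ω * ‖y ω - u‖ ^ 2 ∂μ =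
      ∫ ω, k ω * ‖y ω‖ ^ 2 ∂μ - 2 * inner ℝ u (∫ ω, k ω • y ω ∂μ) +
        ‖u‖ ^ 2 * ∫ ω, k ω ∂μ := fun u ↦ by
    simp_rw [hexp]
    have h1 : Integrable (fun ω ↦ k ω * ‖y ω‖ ^ 2 - 2 * inner ℝ u (k ω • y ω)) μ :=
      hky2.sub ((hin u).const_mul 2)
    rw [integral_add h1 (hk.const_mul _), integral_sub hky2 ((hin u).const_mul 2),
      integral_const_mul, integral_const_mul,
      integral_inner hky]
  rw [hl, hl, ← ofReal_norm, ← ENNReal.ofReal_pow (norm_nonneg _), ← ENNReal.ofReal_mul hZ.le,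
    ← ENNReal.ofReal_add (integral_nonneg fun ω ↦ mul_nonneg (hk0 ω) (sq_nonneg _))
      (by positivity), hi, hi, norm_sub_sq_real, inner_smul_right, inner_smul_left, norm_smul,
      real_inner_self_eq_norm_sq]
  congr 1
  simp only [norm_inv, Real.norm_eq_abs, abs_of_pos hZ, map_inv₀, conj_trivial]
  field_simp
  ring

end BiasVariance

/-! ### Regression with a Gaussian likelihood -/

section GaussianRegression

variable {d : ℕ}

lemma measurable_gaussDensity_comp {α : Type*} [MeasurableSpace α] {m y : α → E d} {v : α → ℝ}
    (hm : Measurable m) (hv : Measurable v) (hy : Measurable y) :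
    Measurable fun z ↦ gaussDensity (m z) (v z) (y z) := by
  unfold gaussDensity
  fun_prop

lemma mul_exp_neg_le_one (u : ℝ) : u * Real.exp (-u) ≤ 1 := by
  rw [Real.exp_neg, ← div_eq_mul_inv, div_le_one (Real.exp_pos u)]
  linarith [Real.add_one_le_exp u]

lemma gaussDensity_le (m : E d) {v : ℝ} (hv : 0 < v) (y : E d) :
    gaussDensity m v y ≤ (2 * Real.pi * v) ^ (-(d / 2 : ℝ)) := by
  unfold gaussDensity
  refine mul_le_of_le_one_right (by positivity) (Real.exp_le_one_iff.2 ?_)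
  rw [neg_nonpos]; positivity

lemma gaussDensity_mul_sq_le (m : E d) {v : ℝ} (hv : 0 < v) (y : E d) :
    gaussDensity m v y * ‖y - m‖ ^ 2 ≤ (2 * Real.pi * v) ^ (-(d / 2 : ℝ)) * (2 * v) := by
  unfold gaussDensity
  rw [mul_assoc]
  refine mul_le_mul_of_nonneg_left ?_ (by positivity)
  have h := mul_exp_neg_le_one (‖y - m‖ ^ 2 / (2 * v))
  rw [div_mul_eq_mul_div, div_le_one (by positivity)] at h
  linarith

lemma lintegral_gaussDensity_mul_enorm_sq (m : E d) (v : ℝ) :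
    ∫⁻ x, ENNReal.ofReal (gaussDensity m v x) * ‖x - m‖ₑ ^ 2 =
      ∫⁻ x : E d, ENNReal.ofReal (gaussDensity 0 v x) * ‖x‖ₑ ^ 2 := by
  rw [← lintegral_sub_right_eq_self
    (fun x : E d ↦ ENNReal.ofReal (gaussDensity 0 v x) * ‖x‖ₑ ^ 2) m]
  simp [gaussDensity]

lemma lintegral_gaussDensity_mul_enorm_sq_lt_top {v : ℝ} (hv : 0 < v) :
    ∫⁻ x : E d, ENNReal.ofReal (gaussDensity 0 v x) * ‖x‖ₑ ^ 2 < ∞ := by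
  have h : MemLp id 2 (multivariateGaussian (0 : E d) (v • (1 : Matrix (Fin d) (Fin d) ℝ))) :=
    IsGaussian.memLp_id _ 2 (by simp)
  have h2 := ((memLp_two_iff_integrable_sq_norm h.1).1 h).2
  rw [multivariateGaussian_smul_one 0 hv] at h2
  have hc := continuous_gaussDensity (0 : E d) v
  rw [HasFiniteIntegral, lintegral_withDensity_eq_lintegral_mul₀ (by fun_prop)
    (by fun_prop)] at h2
  simpa [enorm_pow] using h2

variable (μ₁ : Measure (E d)) (a : E d) (A C S c e : ℝ → ℝ)

/-- The density of `x` given `x₁` in the regression problem with means `A t • x₁ + C t • a` and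
variances `S t`. -/
noncomputable def likelihood (t : ℝ) (x₁ x : E d) : ℝ :=
  gaussDensity (A t • x₁ + C t • a) (S t) x

/-- The marginal density of `x`. -/
noncomputable def marginal (t : ℝ) (x : E d) : ℝ := ∫ x₁, likelihood a A C S t x₁ x ∂μ₁

/-- The conditional expectation of `c t • (x₁ - e t • x)` given `x`. -/
noncomputable def posteriorMean (x : E d) (t : ℝ) : E d :=
  (marginal μ₁ a A C S t x)⁻¹ • ∫ x₁, likelihood a A C S t x₁ x • c t • (x₁ - e t • x) ∂μ₁

/-- The regression loss attributable to the bias of `v`. -/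
noncomputable def excessLoss (t : ℝ) (v : E d → E d) : ℝ≥0∞ :=
  ∫⁻ x, ENNReal.ofReal (marginal μ₁ a A C S t x) * ‖v x - posteriorMean μ₁ a A C S c e x t‖ₑ ^ 2

variable {A C S c e}

lemma measurable_likelihood_comp {α : Type*} [MeasurableSpace α] (hA : Measurable A)
    (hC : Measurable C) (hS : Measurable S) {t : α → ℝ} {x₁ x : α → E d} (ht : Measurable t)
    (hx₁ : Measurable x₁) (hx : Measurable x) :
    Measurable fun z ↦ likelihood a A C S (t z) (x₁ z) (x z) :=
  measurable_gaussDensity_comp (by fun_prop) (by fun_prop) hx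

lemma measurable_marginal [SFinite μ₁] (hA : Measurable A) (hC : Measurable C)
    (hS : Measurable S) : Measurable fun p : E d × ℝ ↦ marginal μ₁ a A C S p.2 p.1 := by
  have h : Measurable fun z : (E d × ℝ) × E d ↦ likelihood a A C S z.1.2 z.2 z.1.1 :=
    measurable_likelihood_comp a hA hC hS (by fun_prop) (by fun_prop) (by fun_prop)
  exact (h.stronglyMeasurable.integral_prod_right' (ν := μ₁)).measurable

lemma measurable_posteriorMean [SFinite μ₁] (hA : Measurable A) (hC : Measurable C)
    (hS : Measurable S) (hc : Measurable c) (he : Measurable e) :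
    Measurable fun p : E d × ℝ ↦ posteriorMean μ₁ a A C S c e p.1 p.2 := by
  have h : Measurable fun z : (E d × ℝ) × E d ↦ likelihood a A C S z.1.2 z.2 z.1.1 :=
    measurable_likelihood_comp a hA hC hS (by fun_prop) (by fun_prop) (by fun_prop)
  have h' : Measurable fun z : (E d × ℝ) × E d ↦ likelihood a A C S z.1.2 z.2 z.1.1 •
      c z.1.2 • (z.2 - e z.1.2 • z.1.1) := by fun_prop
  have h'' := (h'.stronglyMeasurable.integral_prod_right' (ν := μ₁)).measurable
  exact (measurable_marginal μ₁ a hA hC hS).inv.smul h''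

lemma measurable_marginal_at [SFinite μ₁] (hA : Measurable A) (hC : Measurable C)
    (hS : Measurable S) (t : ℝ) : Measurable (marginal μ₁ a A C S t) :=
  Measurable.comp (g := fun p : E d × ℝ ↦ marginal μ₁ a A C S p.2 p.1) (f := fun x ↦ (x, t))
    (measurable_marginal μ₁ a hA hC hS) measurable_prodMk_right

lemma measurable_posteriorMean_at [SFinite μ₁] (hA : Measurable A) (hC : Measurable C)
    (hS : Measurable S) (hc : Measurable c) (he : Measurable e) (t : ℝ) :
    Measurable fun x ↦ posteriorMean μ₁ a A C S c e x t :=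
  Measurable.comp (g := fun p : E d × ℝ ↦ posteriorMean μ₁ a A C S c e p.1 p.2)
    (f := fun x ↦ (x, t)) (measurable_posteriorMean μ₁ a hA hC hS hc he) measurable_prodMk_right

section FixedTime

variable {t : ℝ}

lemma likelihood_pos (hS0 : 0 < S t) (x x₁ : E d) : 0 < likelihood a A C S t x₁ x :=
  gaussDensity_pos _ hS0 _

lemma measurable_likelihood_left (x : E d) :
    Measurable fun x₁ ↦ likelihood a A C S t x₁ x := by
  unfold likelihood
  exact measurable_gaussDensity_comp (by fun_prop) (by fun_prop) (by fun_prop)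

lemma integrable_likelihood [IsFiniteMeasure μ₁] (hS0 : 0 < S t) (x : E d) :
    Integrable (fun x₁ ↦ likelihood a A C S t x₁ x) μ₁ := by
  refine .of_bound (measurable_likelihood_left a x).aestronglyMeasurable
    ((2 * Real.pi * S t) ^ (-(d / 2 : ℝ))) (.of_forall fun x₁ ↦ ?_)
  rw [Real.norm_of_nonneg (likelihood_pos a hS0 x x₁).le]
  exact gaussDensity_le _ hS0 _

lemma marginal_pos [IsProbabilityMeasure μ₁] (hS0 : 0 < S t) (x : E d) :
    0 < marginal μ₁ a A C S t x := by
  unfold marginal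
  rw [integral_pos_iff_support_of_nonneg (fun x₁ ↦ (likelihood_pos a hS0 x x₁).le)
    (integrable_likelihood μ₁ a hS0 x)]
  have : Function.support (fun x₁ ↦ likelihood a A C S t x₁ x) = univ :=
    eq_univ_of_forall fun x₁ ↦ (likelihood_pos a hS0 x x₁).ne'
  simp [this]

/-- Since `A t ≠ 0`, the target is affine in the residual `x - (A t • x₁ + C t • a)`, and a Gaussian
times its squared residual is bounded. So the integrand is bounded in `x₁`, and a finite `μ₁`
suffices without any moment. -/
lemma integrable_likelihood_mul_sq [IsFiniteMeasure μ₁] (hS0 : 0 < S t) (x : E d) (hA0 : A t ≠ 0) :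
    Integrable (fun x₁ ↦ likelihood a A C S t x₁ x * ‖c t • (x₁ - e t • x)‖ ^ 2) μ₁ := by
  have hm := measurable_likelihood_left (A := A) (C := C) (S := S) (t := t) a x
  let p : E d := (A t)⁻¹ • (x - C t • a) - e t • x
  let N : ℝ := (2 * Real.pi * S t) ^ (-(d / 2 : ℝ))
  refine .of_bound (Measurable.aestronglyMeasurable (by fun_prop))
    (c t ^ 2 * (2 * ‖p‖ ^ 2 * N + 2 * (A t)⁻¹ ^ 2 * (N * (2 * S t)))) (.of_forall fun x₁ ↦ ?_)
  have hl := likelihood_pos (A := A) (C := C) a hS0 x x₁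
  have h1 : likelihood a A C S t x₁ x ≤ N := gaussDensity_le _ hS0 _
  have h2 : likelihood a A C S t x₁ x * ‖x - (A t • x₁ + C t • a)‖ ^ 2 ≤ N * (2 * S t) :=
    gaussDensity_mul_sq_le _ hS0 _
  have h3 : x₁ - e t • x = p - (A t)⁻¹ • (x - (A t • x₁ + C t • a)) := by
    simp only [p, smul_sub, smul_add, smul_smul, inv_mul_cancel₀ hA0, one_smul]
    abel
  have h4 : ‖x₁ - e t • x‖ ^ 2 ≤
      2 * ‖p‖ ^ 2 + 2 * (A t)⁻¹ ^ 2 * ‖x - (A t • x₁ + C t • a)‖ ^ 2 := by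
    have h5 := norm_sub_le p ((A t)⁻¹ • (x - (A t • x₁ + C t • a)))
    rw [← h3] at h5
    have h6 : ‖(A t)⁻¹ • (x - (A t • x₁ + C t • a))‖ ^ 2 =
        (A t)⁻¹ ^ 2 * ‖x - (A t • x₁ + C t • a)‖ ^ 2 := by
      rw [norm_smul, mul_pow, Real.norm_eq_abs, sq_abs]
    rw [mul_assoc, ← h6]
    nlinarith [norm_nonneg (x₁ - e t • x), norm_nonneg p,
      norm_nonneg ((A t)⁻¹ • (x - (A t • x₁ + C t • a))),
      sq_nonneg (‖p‖ - ‖(A t)⁻¹ • (x - (A t • x₁ + C t • a))‖)]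
  rw [Real.norm_of_nonneg (by positivity), norm_smul, mul_pow, Real.norm_eq_abs, sq_abs,
    mul_left_comm]
  refine mul_le_mul_of_nonneg_left ?_ (sq_nonneg _)
  calc likelihood a A C S t x₁ x * ‖x₁ - e t • x‖ ^ 2
      ≤ likelihood a A C S t x₁ x *
        (2 * ‖p‖ ^ 2 + 2 * (A t)⁻¹ ^ 2 * ‖x - (A t • x₁ + C t • a)‖ ^ 2) := by gcongr
    _ = 2 * ‖p‖ ^ 2 * likelihood a A C S t x₁ x + 2 * (A t)⁻¹ ^ 2 *
        (likelihood a A C S t x₁ x * ‖x - (A t • x₁ + C t • a)‖ ^ 2) := by ring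
    _ ≤ _ := by gcongr

lemma integrable_likelihood_smul [IsFiniteMeasure μ₁] (hS0 : 0 < S t) (x : E d) (hA0 : A t ≠ 0) :
    Integrable (fun x₁ ↦ likelihood a A C S t x₁ x • c t • (x₁ - e t • x)) μ₁ := by
  have hm := measurable_likelihood_left (A := A) (C := C) (S := S) (t := t) a x
  refine ((integrable_likelihood (A := A) (C := C) μ₁ a hS0 x).add
    (integrable_likelihood_mul_sq (A := A) (C := C) (c := c) (e := e) μ₁ a hS0 x hA0)).mono'
    (Measurable.aestronglyMeasurable (by fun_prop)) (.of_forall fun x₁ ↦ ?_)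
  have hl := likelihood_pos (A := A) (C := C) a hS0 x x₁
  rw [norm_smul, Real.norm_of_nonneg hl.le, Pi.add_apply]
  -- Uses `‖z‖ ≤ 1 + ‖z‖ ^ 2`.
  nlinarith [sq_nonneg (‖c t • (x₁ - e t • x)‖ - 1), norm_nonneg (c t • (x₁ - e t • x))]

lemma lintegral_likelihood_mul_enorm_sub_sq [IsProbabilityMeasure μ₁] (hS0 : 0 < S t)
    (hA0 : A t ≠ 0) (x v : E d) :
    ∫⁻ x₁, ENNReal.ofReal (likelihood a A C S t x₁ x) * ‖c t • (x₁ - e t • x) - v‖ₑ ^ 2 ∂μ₁ =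
      ∫⁻ x₁, ENNReal.ofReal (likelihood a A C S t x₁ x) *
        ‖c t • (x₁ - e t • x) - posteriorMean μ₁ a A C S c e x t‖ₑ ^ 2 ∂μ₁ +
      ENNReal.ofReal (marginal μ₁ a A C S t x) * ‖v - posteriorMean μ₁ a A C S c e x t‖ₑ ^ 2 := by
  have h0 := fun x₁ ↦ (likelihood_pos (A := A) (C := C) a hS0 x x₁).le
  have h1 := integrable_likelihood (A := A) (C := C) μ₁ a hS0 x
  have h2 := integrable_likelihood_smul (C := C) (c := c) (e := e) μ₁ a hS0 x hA0
  have h3 := integrable_likelihood_mul_sq (C := C) (c := c) (e := e) μ₁ a hS0 x hA0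
  exact lintegral_mul_enorm_sub_sq h0 h1 h2 h3 (marginal_pos μ₁ a hS0 x) v

end FixedTime

variable {m : ℝ → E d → E d} {s2 : ℝ → ℝ} {y : ℝ → E d → E d → E d} {t : ℝ}

lemma lossAt_eq_lintegral_likelihood [SFinite μ₁] (hS0 : 0 < S t)
    (hm : ∀ x₁, m t x₁ = A t • x₁ + C t • a) (hs2 : s2 t = S t)
    (hy : ∀ x₁ x, y t x₁ x = c t • (x₁ - e t • x)) {v : E d → E d}
    (hv : AEStronglyMeasurable v volume) :
    lossAt μ₁ m s2 y t v = ∫⁻ x₁, ∫⁻ x, ENNReal.ofReal (likelihood a A C S t x₁ x) *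
      ‖c t • (x₁ - e t • x) - v x‖ₑ ^ 2 ∂volume ∂μ₁ := by
  unfold lossAt
  refine lintegral_congr fun x₁ ↦ ?_
  have hc := continuous_gaussDensity (A t • x₁ + C t • a) (S t)
  rw [hm, hs2, multivariateGaussian_smul_one _ hS0]
  simp_rw [hy]
  have hf : AEMeasurable (fun x ↦ ‖c t • (x₁ - e t • x) - v x‖ₑ ^ 2)
      (volume : Measure (E d)) := by
    have := hv.aemeasurable
    fun_prop
  rw [lintegral_withDensity_eq_lintegral_mul₀ (by fun_prop) hf]
  rfl

lemma lossAt_eq_lintegral_swap [SFinite μ₁] (hA : Measurable A) (hC : Measurable C)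
    (hS : Measurable S) (hS0 : 0 < S t)
    (hm : ∀ x₁, m t x₁ = A t • x₁ + C t • a) (hs2 : s2 t = S t)
    (hy : ∀ x₁ x, y t x₁ x = c t • (x₁ - e t • x)) {v : E d → E d}
    (hv : AEStronglyMeasurable v volume) :
    lossAt μ₁ m s2 y t v = ∫⁻ x, ∫⁻ x₁, ENNReal.ofReal (likelihood a A C S t x₁ x) *
      ‖c t • (x₁ - e t • x) - v x‖ₑ ^ 2 ∂μ₁ ∂volume := by
  rw [lossAt_eq_lintegral_likelihood μ₁ a hS0 hm hs2 hy hv]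
  have hl : Measurable fun z : E d × E d ↦ likelihood a A C S t z.1 z.2 :=
    measurable_likelihood_comp a hA hC hS measurable_const measurable_fst measurable_snd
  have h1 : AEMeasurable (fun z : E d × E d ↦ v z.2) (μ₁.prod volume) :=
    (hv.comp_snd (μ := μ₁)).aemeasurable
  have h2 : Measurable fun z : E d × E d ↦ c t • (z.1 - e t • z.2) := by fun_prop
  exact lintegral_lintegral_swap (hl.ennreal_ofReal.aemeasurable.mul
    ((h2.aemeasurable.sub h1).enorm.pow_const 2))

/-- The loss of a vector field is the loss of the posterior mean plus the excess loss. -/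
lemma lossAt_eq_add_excessLoss [IsProbabilityMeasure μ₁] (hA : Measurable A) (hC : Measurable C)
    (hS : Measurable S) (hc : Measurable c) (he : Measurable e) (hS0 : 0 < S t) (hA0 : A t ≠ 0)
    (hm : ∀ x₁, m t x₁ = A t • x₁ + C t • a) (hs2 : s2 t = S t)
    (hy : ∀ x₁ x, y t x₁ x = c t • (x₁ - e t • x)) {v : E d → E d}
    (hv : AEStronglyMeasurable v volume) :
    lossAt μ₁ m s2 y t v = lossAt μ₁ m s2 y t (fun x ↦ posteriorMean μ₁ a A C S c e x t) +
      excessLoss μ₁ a A C S c e t v := by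
  have hw : Measurable fun x ↦ posteriorMean μ₁ a A C S c e x t :=
    measurable_posteriorMean_at μ₁ a hA hC hS hc he t
  have hZ := measurable_marginal_at μ₁ a hA hC hS t
  have hswap := fun v hv ↦ lossAt_eq_lintegral_swap (v := v) μ₁ a hA hC hS hS0 hm hs2 hy hv
  rw [hswap v hv, hswap _ hw.aestronglyMeasurable, excessLoss, ← lintegral_add_right']
  · refine lintegral_congr fun x ↦ ?_
    exact lintegral_likelihood_mul_enorm_sub_sq μ₁ a hS0 hA0 x (v x)
  · exact hZ.ennreal_ofReal.aemeasurable.mul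
      ((hv.aemeasurable.sub hw.aemeasurable).enorm.pow_const 2)

/-- Predict `x₁` by solving `x = A t • x₁ + C t • a`. The error is then a multiple of the Gaussian
noise, with the same finite second moment for every `x₁`. -/
lemma exists_lossAt_lt_top [IsProbabilityMeasure μ₁] (hS0 : 0 < S t) (hA0 : A t ≠ 0)
    (hm : ∀ x₁, m t x₁ = A t • x₁ + C t • a) (hs2 : s2 t = S t)
    (hy : ∀ x₁ x, y t x₁ x = c t • (x₁ - e t • x)) :
    ∃ v : E d → E d, AEStronglyMeasurable v volume ∧ lossAt μ₁ m s2 y t v < ∞ := by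
  let v : E d → E d := fun x ↦ c t • ((A t)⁻¹ • (x - C t • a) - e t • x)
  have hv : AEStronglyMeasurable v volume :=
    Measurable.aestronglyMeasurable (by simp only [v]; fun_prop)
  refine ⟨v, hv, ?_⟩
  rw [lossAt_eq_lintegral_likelihood μ₁ a hS0 hm hs2 hy hv]
  have h1 : ∀ x₁ x, c t • (x₁ - e t • x) - v x =
      (-(c t * (A t)⁻¹)) • (x - (A t • x₁ + C t • a)) := fun x₁ x ↦ by
    have h2 : x₁ = (A t)⁻¹ • A t • x₁ := by rw [smul_smul, inv_mul_cancel₀ hA0, one_smul]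
    nth_rw 1 [h2]
    simp only [v]
    module
  have h3 : ∀ x₁, ∫⁻ x, ENNReal.ofReal (likelihood a A C S t x₁ x) *
      ‖c t • (x₁ - e t • x) - v x‖ₑ ^ 2 = ‖-(c t * (A t)⁻¹)‖ₑ ^ 2 *
        ∫⁻ x : E d, ENNReal.ofReal (gaussDensity 0 (S t) x) * ‖x‖ₑ ^ 2 := fun x₁ ↦ by
    rw [← lintegral_gaussDensity_mul_enorm_sq (A t • x₁ + C t • a) (S t),
      ← lintegral_const_mul' _ _ (ENNReal.pow_ne_top enorm_ne_top)]
    refine lintegral_congr fun x ↦ ?_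
    rw [h1, enorm_smul, mul_pow, mul_left_comm]
    rfl
  simp_rw [h3]
  rw [lintegral_const, measure_univ, mul_one]
  exact ENNReal.mul_lt_top (ENNReal.pow_lt_top enorm_lt_top)
    (lintegral_gaussDensity_mul_enorm_sq_lt_top hS0)

lemma isUniqueMinimizer_posteriorMean [IsProbabilityMeasure μ₁] (hA : Measurable A)
    (hC : Measurable C) (hS : Measurable S) (hc : Measurable c) (he : Measurable e)
    (hS0 : ∀ t ∈ Ioo (0 : ℝ) 1, 0 < S t) (hA0 : ∀ t ∈ Ioo (0 : ℝ) 1, A t ≠ 0)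
    (hm : ∀ t ∈ Ioo (0 : ℝ) 1, ∀ x₁, m t x₁ = A t • x₁ + C t • a)
    (hs2 : ∀ t ∈ Ioo (0 : ℝ) 1, s2 t = S t)
    (hy : ∀ t ∈ Ioo (0 : ℝ) 1, ∀ x₁ x, y t x₁ x = c t • (x₁ - e t • x)) {w : E d → ℝ → E d}
    (hw : ∀ t ∈ Ioo (0 : ℝ) 1, ∀ x, w x t = posteriorMean μ₁ a A C S c e x t) :
    IsUniqueMinimizer μ₁ m s2 y w := by
  have hpm := measurable_posteriorMean μ₁ a hA hC hS hc he
  have hZm := measurable_marginal μ₁ a hA hC hS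
  have hwt : ∀ t ∈ Ioo (0 : ℝ) 1, (fun x ↦ w x t) =
      fun x ↦ posteriorMean μ₁ a A C S c e x t := fun t ht ↦ funext (hw t ht)
  have hwm : ∀ t ∈ Ioo (0 : ℝ) 1, Measurable fun x ↦ w x t := fun t ht ↦ by
    rw [hwt t ht]; exact measurable_posteriorMean_at μ₁ a hA hC hS hc he t
  have hdec : ∀ t ∈ Ioo (0 : ℝ) 1, ∀ v : E d → E d, AEStronglyMeasurable v volume →
      lossAt μ₁ m s2 y t v = lossAt μ₁ m s2 y t (fun x ↦ w x t) +
        excessLoss μ₁ a A C S c e t v := fun t ht v hv ↦ by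
    rw [hwt t ht]
    exact lossAt_eq_add_excessLoss μ₁ a hA hC hS hc he (hS0 t ht) (hA0 t ht) (hm t ht)
      (hs2 t ht) (hy t ht) hv
  -- The posterior mean does no worse than the predictor of finite loss.
  have hfin : ∀ t ∈ Ioo (0 : ℝ) 1, lossAt μ₁ m s2 y t (fun x ↦ w x t) < ∞ := fun t ht ↦ by
    obtain ⟨v, hv, hvt⟩ := exists_lossAt_lt_top μ₁ a (hS0 t ht) (hA0 t ht) (hm t ht) (hs2 t ht)
      (hy t ht)
    exact (le_self_add.trans_eq (hdec t ht v hv).symm).trans_lt hvt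
  have hmem : ∀ᵐ p ∂spaceTime d, p.2 ∈ Ioo (0 : ℝ) 1 :=
    Measure.quasiMeasurePreserving_snd.ae (ae_restrict_mem measurableSet_Ioo)
  have hwae : (fun p : E d × ℝ ↦ w p.1 p.2) =ᵐ[spaceTime d]
      fun p ↦ posteriorMean μ₁ a A C S c e p.1 p.2 := by
    filter_upwards [hmem] with p hp using hw p.2 hp p.1
  have hslice : ∀ u : E d → ℝ → E d,
      AEStronglyMeasurable (fun p : E d × ℝ ↦ u p.1 p.2) (spaceTime d) →
      ∀ᵐ t ∂volume.restrict (Ioo (0 : ℝ) 1), t ∈ Ioo (0 : ℝ) 1 ∧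
        AEStronglyMeasurable (fun x ↦ u x t) volume := fun u hu ↦
    (ae_restrict_mem measurableSet_Ioo).and hu.prod_swap.prodMk_left
  have hzero : ∀ {z : ℝ} {b : E d}, 0 < z → (ENNReal.ofReal z * ‖b‖ₑ ^ 2 = 0 ↔ b = 0) :=
    fun {z b} hz ↦ by simp [hz.not_ge]
  -- Cancellation in `ℝ≥0∞` needs a finite term; this is where uniqueness over all times uses
  -- finiteness of the minimum.
  have hadd : ∀ {p r : ℝ≥0∞}, p ≠ ∞ → (p + r = p ↔ r = 0) := fun {p r} hp ↦ by
    simpa using ENNReal.add_right_inj (b := r) (c := 0) hp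
  refine ⟨⟨_, hpm.stronglyMeasurable, hwae⟩, fun u hu ↦ ?_, fun hlt u hu ↦ ?_,
    fun t ht ↦ (hwm t ht).aestronglyMeasurable, hfin,
    fun t ht v hv ↦ le_self_add.trans_eq (hdec t ht v hv).symm, fun t ht v hv ↦ ?_⟩
  · refine lintegral_mono_ae ?_
    filter_upwards [hslice u hu] with t ht
    exact le_self_add.trans_eq (hdec t ht.1 _ ht.2).symm
  · have hum := hu.aemeasurable
    have hF : AEMeasurable (fun p : E d × ℝ ↦ ENNReal.ofReal (marginal μ₁ a A C S p.2 p.1) *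
        ‖u p.1 p.2 - posteriorMean μ₁ a A C S c e p.1 p.2‖ₑ ^ 2) (spaceTime d) :=
      hZm.ennreal_ofReal.aemeasurable.mul ((hum.sub hpm.aemeasurable).enorm.pow_const 2)
    have hD : AEMeasurable (fun t ↦ excessLoss μ₁ a A C S c e t (fun x ↦ u x t))
        (volume.restrict (Ioo (0 : ℝ) 1)) := hF.prod_swap.lintegral_prod_right'
    have h1 : loss μ₁ m s2 y u = loss μ₁ m s2 y w +
        ∫⁻ t in Ioo (0 : ℝ) 1, excessLoss μ₁ a A C S c e t (fun x ↦ u x t) := by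
      unfold loss
      rw [← lintegral_add_right' _ hD]
      refine lintegral_congr_ae ?_
      filter_upwards [hslice u hu] with t ht using hdec t ht.1 _ ht.2
    -- On the product space, a vanishing excess gives equality almost everywhere in space-time at
    -- once, instead of a separate null set for each time.
    have h2 : ∫⁻ t in Ioo (0 : ℝ) 1, excessLoss μ₁ a A C S c e t (fun x ↦ u x t) =
        ∫⁻ p, ENNReal.ofReal (marginal μ₁ a A C S p.2 p.1) *
        ‖u p.1 p.2 - posteriorMean μ₁ a A C S c e p.1 p.2‖ₑ ^ 2 ∂spaceTime d :=
      (lintegral_prod_symm _ hF).symm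
    rw [h1, hadd hlt.ne, h2, lintegral_eq_zero_iff' hF]
    constructor
    · intro h
      filter_upwards [h, hmem, hwae] with p hp hp1 hp2
      rw [hp2]
      exact sub_eq_zero.1 ((hzero (marginal_pos μ₁ a (hS0 _ hp1) p.1)).1 hp)
    · intro h
      filter_upwards [h, hwae] with p hp hp2
      simp [hp, hp2]
  · have hZ := measurable_marginal_at μ₁ a hA hC hS t
    have hp := measurable_posteriorMean_at μ₁ a hA hC hS hc he t
    have hvm := hv.aemeasurable
    have hF : AEMeasurable (fun x ↦ ENNReal.ofReal (marginal μ₁ a A C S t x) *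
        ‖v x - posteriorMean μ₁ a A C S c e x t‖ₑ ^ 2) volume :=
      hZ.ennreal_ofReal.aemeasurable.mul ((hvm.sub hp.aemeasurable).enorm.pow_const 2)
    rw [hdec t ht v hv, hadd (hfin t ht).ne, excessLoss, lintegral_eq_zero_iff' hF, hwt t ht]
    refine eventually_congr (.of_forall fun x ↦ ?_)
    exact (hzero (marginal_pos μ₁ a (hS0 t ht) x)).trans sub_eq_zero

end GaussianRegression

/-! ### The bridge drift as a posterior mean -/

variable {d : ℕ}

lemma hasGradientAt_gaussDensity_smul (e v : ℝ) (x x₁ : E d) :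
    HasGradientAt (fun x' ↦ gaussDensity (e • x') v x₁)
      ((e / v * gaussDensity (e • x) v x₁) • (x₁ - e • x)) x := by
  rw [hasGradientAt_iff_hasFDerivAt]
  have h1 : HasFDerivAt (fun x' : E d ↦ x₁ - e • x')
      (-(e • ContinuousLinearMap.id ℝ (E d))) x :=
    ((hasFDerivAt_id x).const_smul e).const_sub x₁
  have h2 := ((h1.norm_sq.mul_const (2 * v)⁻¹).neg.exp).const_mul
    ((2 * Real.pi * v) ^ (-(d / 2 : ℝ)))
  simp only [Pi.neg_apply, ← div_eq_mul_inv] at h2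
  refine h2.congr_fderiv ?_
  ext z
  simp [gaussDensity]
  ring

/-- Bayes' formula for Gaussians: given `x₁`, the law of `x` has a density proportional to the
ratio of transition densities. -/
lemma exists_gaussDensity_eq_mul_div {e v e₀ v₀ : ℝ} (he : 0 < e) (hv : 0 < v)
    (hvv : v < v₀) (a x : E d) :
    ∃ h > 0, ∀ x₁ : E d, gaussDensity (((v₀ - v) / (e * v₀)) • x₁ + (e₀ * v / (e * v₀)) • a)
      (v * (v₀ - v) / (e ^ 2 * v₀)) x =
      h * (gaussDensity (e • x) v x₁ / gaussDensity (e₀ • a) v₀ x₁) := by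
  obtain ⟨w, hw, rfl⟩ : ∃ w, 0 < w ∧ v₀ = v + w := ⟨v₀ - v, sub_pos.2 hvv, by ring⟩
  have hv₀ : 0 < v + w := by positivity
  rw [add_sub_cancel_left]
  set S := v * w / (e ^ 2 * (v + w)) with hS
  have hS0 : 0 < S := by positivity
  let N : ℝ → ℝ := fun v ↦ (2 * Real.pi * v) ^ (-(d / 2 : ℝ))
  have hN : ∀ v, 0 < v → 0 < N v := fun v hv ↦ by positivity
  -- Everything free of `x₁` goes into `h`. It is the density at `x` of the Gaussian with mean `(e₀
  -- / e) • a` and variance `w / e ^ 2`, in the role of `q(0, a, t, x)`.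
  refine ⟨N S * N (v + w) / N v * Real.exp (-(‖x - (e₀ * v / (e * (v + w))) • a‖ ^ 2 / (2 * S)) +
    ‖e • x‖ ^ 2 / (2 * v) - ‖e₀ • a‖ ^ 2 / (2 * (v + w))), ?_, fun x₁ ↦ ?_⟩
  · have := hN S hS0; have := hN v hv; have := hN (v + w) hv₀; positivity
  · have h1 : ∀ (m : E d) (v : ℝ) (y : E d), gaussDensity m v y =
        N v * Real.exp (-(‖y - m‖ ^ 2 / (2 * v))) := fun _ _ _ ↦ rfl
    rw [h1, h1, h1]
    have h2 := (hN v hv).ne'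
    have h3 := (hN (v + w) hv₀).ne'
    have hexp : Real.exp (-(‖x - ((w / (e * (v + w))) • x₁ + (e₀ * v / (e * (v + w))) • a)‖ ^ 2 /
        (2 * S))) = Real.exp (-(‖x - (e₀ * v / (e * (v + w))) • a‖ ^ 2 / (2 * S)) +
        ‖e • x‖ ^ 2 / (2 * v) - ‖e₀ • a‖ ^ 2 / (2 * (v + w))) *
        (Real.exp (-(‖x₁ - e • x‖ ^ 2 / (2 * v))) /
          Real.exp (-(‖x₁ - e₀ • a‖ ^ 2 / (2 * (v + w))))) := by
      rw [← Real.exp_sub, ← Real.exp_add]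
      congr 1
      have h4 : x - ((w / (e * (v + w))) • x₁ + (e₀ * v / (e * (v + w))) • a) =
          (x - (e₀ * v / (e * (v + w))) • a) - (w / (e * (v + w))) • x₁ := by abel
      rw [h4, norm_sub_sq_real, norm_sub_sq_real x₁, norm_sub_sq_real x₁]
      simp only [inner_sub_left, inner_smul_left, inner_smul_right, norm_smul, mul_pow,
        Real.norm_eq_abs, sq_abs, conj_trivial, real_inner_comm x x₁, real_inner_comm a x₁]
      rw [hS]
      field_simp
      ring
    rw [hexp]
    field_simp

/-- Differentiating the Gaussian in its mean brings down `(e t / v) • (x₁ - e t • x)`, which is the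
target up to the factor `σ t ^ 2`. The Bayes factor `h` occurs in the numerator and the denominator
and cancels. -/
lemma bridgeDrift_eq_posteriorMean {q : ℝ → E d → ℝ → E d → ℝ} {σ : ℝ → ℝ} {a : E d}
    {μ₁ : Measure (E d)} {A C S c e : ℝ → ℝ} {t v e₀ v₀ : ℝ}
    (he : 0 < e t) (hv : 0 < v) (hvv : v < v₀)
    (hq : ∀ x x₁, q t x 1 x₁ = gaussDensity (e t • x) v x₁)
    (hq₀ : ∀ x₁, q 0 a 1 x₁ = gaussDensity (e₀ • a) v₀ x₁)
    (hA : A t = (v₀ - v) / (e t * v₀)) (hC : C t = e₀ * v / (e t * v₀))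
    (hS : S t = v * (v₀ - v) / (e t ^ 2 * v₀)) (hc : c t = σ t ^ 2 * (e t / v)) (x : E d) :
    bridgeDrift σ q a μ₁ x t = posteriorMean μ₁ a A C S c e x t := by
  obtain ⟨h, hh, hbayes⟩ := exists_gaussDensity_eq_mul_div he hv hvv a x
  have hr : ∀ x₁, likelihood a A C S t x₁ x = h * bridgeRatio q a t x x₁ := fun x₁ ↦ by
    rw [likelihood, hA, hC, hS, hbayes, bridgeRatio, hq, hq₀]
  have hgrad : ∀ x₁, gradient (fun x' ↦ bridgeRatio q a t x' x₁) x =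
      (e t / v * bridgeRatio q a t x x₁) • (x₁ - e t • x) := fun x₁ ↦ by
    have h1 := (hasGradientAt_iff_hasFDerivAt.1
      (hasGradientAt_gaussDensity_smul (e t) v x x₁)).mul_const (gaussDensity (e₀ • a) v₀ x₁)⁻¹
    have h2 : HasGradientAt (fun x' ↦ bridgeRatio q a t x' x₁)
        ((e t / v * bridgeRatio q a t x x₁) • (x₁ - e t • x)) x := by
      rw [hasGradientAt_iff_hasFDerivAt]
      simp only [bridgeRatio, hq, hq₀, div_eq_mul_inv]
      refine h1.congr_fderiv ?_
      ext z
      simp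
      ring
    exact h2.gradient
  unfold bridgeDrift posteriorMean marginal
  simp_rw [hgrad, hr, hc]
  rw [integral_const_mul]
  have h3 : ∀ x₁, (h * bridgeRatio q a t x x₁) • (σ t ^ 2 * (e t / v)) • (x₁ - e t • x) =
      (h * σ t ^ 2) • (e t / v * bridgeRatio q a t x x₁) • (x₁ - e t • x) := fun x₁ ↦ by
    rw [smul_smul, smul_smul]; congr 1; ring
  simp_rw [h3]
  rw [integral_smul, smul_smul]
  congr 1
  field_simp

/-- The common form of both cases: a reference process with Gaussian transitions, whose drift is
linear and whose coefficients are continuous. -/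
lemma isUniqueMinimizer_bridgeDrift (a : E d) (μ₁ : Measure (E d)) [IsProbabilityMeasure μ₁]
    {B : E d → ℝ → E d} {σ b γ v : ℝ → ℝ} {q : ℝ → E d → ℝ → E d → ℝ}
    (hq : IsTransitionDensity B σ q) (hb : Continuous b)
    (hB : ∀ y, ∀ r ∈ Icc (0 : ℝ) 1, B y r = -(b r • y)) (hγ : Continuous γ)
    (hσ : ∀ r ∈ Icc (0 : ℝ) 1, σ r ^ 2 = γ r) (hv : Measurable v)
    (hvI : ∀ t ∈ Ico (0 : ℝ) 1, v t = ∫ r in t..1, decay b 1 r ^ 2 * γ r)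
    (hv0 : ∀ t ∈ Ico (0 : ℝ) 1, 0 < v t) (hvv : ∀ t ∈ Ioo (0 : ℝ) 1, v t < v 0)
    {m : ℝ → E d → E d} {s2 : ℝ → ℝ} {y : ℝ → E d → E d → E d}
    (hm : ∀ t ∈ Ioo (0 : ℝ) 1, ∀ x₁, m t x₁ = ((v 0 - v t) / (decay b 1 t * v 0)) • x₁ +
      (decay b 1 0 * v t / (decay b 1 t * v 0)) • a)
    (hs2 : ∀ t ∈ Ioo (0 : ℝ) 1, s2 t = v t * (v 0 - v t) / (decay b 1 t ^ 2 * v 0))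
    (hy : ∀ t ∈ Ioo (0 : ℝ) 1, ∀ x₁ x,
      y t x₁ x = (γ t * (decay b 1 t / v t)) • (x₁ - decay b 1 t • x)) :
    IsUniqueMinimizer μ₁ m s2 y (bridgeDrift σ q a μ₁) := by
  have he := (continuous_decay hb 1).measurable
  have he0 : ∀ t, 0 < decay b 1 t := fun t ↦ Real.exp_pos _
  have hγm := hγ.measurable
  have h0 : (0 : ℝ) ∈ Ico (0 : ℝ) 1 := by simp
  have hqt : ∀ t ∈ Ico (0 : ℝ) 1, ∀ x x₁, q t x 1 x₁ =
      gaussDensity (decay b 1 t • x) (v t) x₁ := fun t ht x x₁ ↦ by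
    have hpos := hv0 t ht
    rw [hvI t ht] at hpos ⊢
    exact hq.eq_gaussDensity hb hB hγ.continuousOn hσ ht.1 ht.2 le_rfl hpos x x₁
  refine isUniqueMinimizer_posteriorMean μ₁ a
    (A := fun t ↦ (v 0 - v t) / (decay b 1 t * v 0))
    (C := fun t ↦ decay b 1 0 * v t / (decay b 1 t * v 0))
    (S := fun t ↦ v t * (v 0 - v t) / (decay b 1 t ^ 2 * v 0))
    (c := fun t ↦ γ t * (decay b 1 t / v t)) (e := decay b 1)
    (by fun_prop) (by fun_prop) (by fun_prop) (by fun_prop) he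
    (fun t ht ↦ ?_) (fun t ht ↦ ?_) hm hs2 hy (fun t ht x ↦ ?_)
  · have := hv0 t (Ioo_subset_Ico_self ht)
    have := hv0 0 h0
    have := sub_pos.2 (hvv t ht)
    have := he0 t
    positivity
  · have := hv0 0 h0
    have := sub_pos.2 (hvv t ht)
    have := he0 t
    positivity
  · have ht' := Ioo_subset_Ico_self ht
    refine bridgeDrift_eq_posteriorMean (he0 t) (hv0 t ht') (hvv t ht) (hqt t ht')
      (hqt 0 h0 a) rfl rfl rfl ?_ x
    rw [hσ t ⟨ht.1.le, ht.2.le⟩]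

/-- With drift coefficient `β / 2` the integrand is the exact derivative of the squared decay
factor. -/
lemma integral_decay_sq_mul {β : ℝ → ℝ} (hβ : Continuous β) (t : ℝ) :
    ∫ r in t..1, decay (fun u ↦ 1 / 2 * β u) 1 r ^ 2 * β r =
      1 - decay (fun u ↦ 1 / 2 * β u) 1 t ^ 2 := by
  have hb : Continuous fun u ↦ 1 / 2 * β u := by fun_prop
  have hφ := continuous_decay hb 1
  have h : ∀ r ∈ uIcc t 1, HasDerivAt (fun r ↦ decay (fun u ↦ 1 / 2 * β u) 1 r ^ 2)
      (decay (fun u ↦ 1 / 2 * β u) 1 r ^ 2 * β r) r := fun r _ ↦ by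
    refine ((hasDerivAt_decay hb 1 r).fun_pow 2).congr_deriv ?_
    ring
  rw [intervalIntegral.integral_eq_sub_of_hasDerivAt h
    (Continuous.intervalIntegrable (by fun_prop) _ _), decay_self, one_pow]

end SchrodingerBridge

/-! ### The two reference processes -/

open SchrodingerBridge in
theorem proposition1 (d : ℕ) (a : E d) (μ₁ : Measure (E d)) [IsProbabilityMeasure μ₁] :
    -- reference `dx = √(α'(t)) dw`
    (∀ (α α' : ℝ → ℝ) (q : ℝ → E d → ℝ → E d → ℝ),
      (∀ t ∈ Icc (0 : ℝ) 1, HasDerivWithinAt α (α' t) (Icc 0 1) t) →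
      ContinuousOn α' (Icc 0 1) →
      StrictMonoOn α (Icc 0 1) →
      IsTransitionDensity (fun _ _ ↦ 0) (fun t ↦ √(α' t)) q →
      IsUniqueMinimizer μ₁
        (fun t x₁ ↦ ((α t - α 0) / (α 1 - α 0)) • x₁ + ((α 1 - α t) / (α 1 - α 0)) • a)
        (fun t ↦ (α t - α 0) * (α 1 - α t) / (α 1 - α 0))
        (fun t x₁ x ↦ (α' t / (α 1 - α t)) • (x₁ - x))
        (bridgeDrift (fun t ↦ √(α' t)) q a μ₁)) ∧
    -- reference `dx = -½ β(t) x dt + √(β(t)) dw`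
    (∀ (β : ℝ → ℝ) (q : ℝ → E d → ℝ → E d → ℝ),
      ContinuousOn β (Icc 0 1) →
      (∀ t ∈ Icc (0 : ℝ) 1, 0 ≤ β t) →
      (∀ s t, 0 ≤ s → s < t → t ≤ 1 → 0 < ∫ r in s..t, β r) →
      IsTransitionDensity (fun x t ↦ -((1 / 2 * β t) • x)) (fun t ↦ √(β t)) q →
      IsUniqueMinimizer μ₁
        (fun t x₁ ↦ (sigma2Sq β t / (xi β t * sigmaSq β t)) • x₁ +
          (tau β * sigma2Sq β t / (xi β t * sigma1Sq β)) • a)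
        (fun t ↦ sigma2Sq β t ^ 2 / (xi β t ^ 2 * sigmaSq β t))
        (fun t x₁ x ↦ (β t * xi β t / (1 - xi β t ^ 2)) • (x₁ - xi β t • x))
        (bridgeDrift (fun t ↦ √(β t)) q a μ₁)) := by
  have h01 : (0 : ℝ) ≤ 1 := zero_le_one
  constructor
  · intro α α' q hα hα' hmono hq
    have h0 : (0 : ℝ) ∈ Icc (0 : ℝ) 1 := by simp
    have h1 : (1 : ℝ) ∈ Icc (0 : ℝ) 1 := by simp
    -- The data are controlled only on `[0, 1]`; extending them constantly beyond the endpoints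
    -- gives globally continuous coefficients without changing the equation.
    let γ : ℝ → ℝ := IccExtend h01 ((Icc 0 1).domRestrict α')
    have hγ : Continuous γ := hα'.domRestrict.Icc_extend'
    have hγα : ∀ t ∈ Icc (0 : ℝ) 1, γ t = α' t := fun t ht ↦ IccExtend_of_mem h01 _ ht
    have hnn : ∀ t ∈ Icc (0 : ℝ) 1, 0 ≤ α' t := fun t ht ↦ by
      have hu := (uniqueDiffOn_Icc (zero_lt_one (α := ℝ))) t ht
      rw [← (hα t ht).derivWithin hu]
      exact hmono.monotoneOn.derivWithin_nonneg
    have hαc : ContinuousOn α (Icc 0 1) := fun t ht ↦ (hα t ht).continuousWithinAt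
    let v : ℝ → ℝ := fun t ↦ α 1 - IccExtend h01 ((Icc 0 1).domRestrict α) t
    have hv : ∀ t ∈ Icc (0 : ℝ) 1, v t = α 1 - α t := fun t ht ↦ by
      simp only [v]; rw [IccExtend_of_mem h01 _ ht]; rfl
    have hvm : Measurable v :=
      (continuous_const.sub (hαc.domRestrict.Icc_extend')).measurable
    -- Without drift there is no decay, and the remaining variance `v t` is `α 1 - α t`.
    have hdec : ∀ t s, decay (fun _ ↦ 0) t s = 1 := fun t s ↦ by simp [decay]
    have hv0 : v 0 = α 1 - α 0 := hv 0 h0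
    have hpos : 0 < α 1 - α 0 := sub_pos.2 (hmono h0 h1 zero_lt_one)
    refine isUniqueMinimizer_bridgeDrift a μ₁ (b := fun _ ↦ 0) (γ := γ) (v := v) hq
      continuous_const (by simp) hγ (fun r hr ↦ ?_) hvm (fun t ht ↦ ?_) (fun t ht ↦ ?_)
      (fun t ht ↦ ?_) (fun t ht x₁ ↦ ?_) (fun t ht ↦ ?_) (fun t ht x₁ x ↦ ?_)
    · rw [hγα r hr, Real.sq_sqrt (hnn r hr)]
    · have ht' := Ico_subset_Icc_self ht
      have hsub : Icc t 1 ⊆ Icc 0 1 := Icc_subset_Icc_left ht.1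
      simp only [hdec, one_pow, one_mul]
      rw [hv t ht', intervalIntegral.integral_eq_sub_of_hasDeriv_right_of_le ht.2.le
        (hαc.mono hsub) (fun r hr ↦ ?_) (hγ.intervalIntegrable _ _)]
      have hr' : r ∈ Ioo (0 : ℝ) 1 := ⟨ht.1.trans_lt hr.1, hr.2⟩
      rw [hγα r (Ioo_subset_Icc_self hr')]
      exact ((hα r (Ioo_subset_Icc_self hr')).hasDerivAt
        (Icc_mem_nhds hr'.1 hr'.2)).hasDerivWithinAt
    · have ht' := Ico_subset_Icc_self ht
      rw [hv t ht']
      exact sub_pos.2 (hmono ht' h1 ht.2)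
    · have ht' := Ioo_subset_Icc_self ht
      rw [hv t ht', hv0]
      linarith [hmono h0 ht' ht.1]
    · rw [hv t (Ioo_subset_Icc_self ht), hv0, hdec, hdec]
      congr 2 <;> ring
    · rw [hv t (Ioo_subset_Icc_self ht), hv0, hdec]
      ring
    · rw [hv t (Ioo_subset_Icc_self ht), hdec, hγα t (Ioo_subset_Icc_self ht), one_smul]
      congr 1; ring
  · intro β q hβ hβ0 hβI hq
    let β' : ℝ → ℝ := IccExtend h01 ((Icc 0 1).domRestrict β)
    have hβ' : Continuous β' := hβ.domRestrict.Icc_extend'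
    have hββ : ∀ t ∈ Icc (0 : ℝ) 1, β' t = β t := fun t ht ↦ IccExtend_of_mem h01 _ ht
    let b : ℝ → ℝ := fun u ↦ 1 / 2 * β' u
    have hb : Continuous b := by fun_prop
    have hint : ∀ t ∈ Icc (0 : ℝ) 1, ∫ u in t..1, β' u = ∫ u in t..1, β u := fun t ht ↦ by
      refine intervalIntegral.integral_congr fun u hu ↦ hββ u ?_
      rw [uIcc_of_le ht.2] at hu
      exact ⟨ht.1.trans hu.1, hu.2⟩
    have hxi : ∀ t ∈ Icc (0 : ℝ) 1, decay b 1 t = xi β t := fun t ht ↦ by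
      rw [decay, xi, intervalIntegral.integral_const_mul, hint t ht, neg_mul]
    have h0 : (0 : ℝ) ∈ Icc (0 : ℝ) 1 := by simp
    have htau : decay b 1 0 = tau β := hxi 0 h0
    have hxi0 : ∀ t, 0 < xi β t := fun t ↦ Real.exp_pos _
    have hxi1 : ∀ t ∈ Ico (0 : ℝ) 1, xi β t < 1 := fun t ht ↦ by
      rw [xi, Real.exp_lt_one_iff]
      linarith [hβI t 1 ht.1 ht.2 le_rfl]
    have hxit : ∀ t ∈ Ioo (0 : ℝ) 1, tau β < xi β t := fun t ht ↦ by
      have hi : ∀ s ∈ Icc (0 : ℝ) 1, IntervalIntegrable β volume 0 s := fun s hs ↦ by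
        refine (hβ.mono ?_).intervalIntegrable
        rw [uIcc_of_le hs.1]
        exact Icc_subset_Icc_right hs.2
      have h := intervalIntegral.integral_interval_sub_left (hi 1 (by simp))
        (hi t (Ioo_subset_Icc_self ht))
      rw [xi, tau, Real.exp_lt_exp]
      linarith [hβI 0 t le_rfl ht.1 ht.2.le]
    have htau0 : 0 < tau β := Real.exp_pos _
    -- Here the decay factor is `ξ`, so `v t` is `σ₂²` and `v 0` is `σ₁²`.
    let v : ℝ → ℝ := fun t ↦ 1 - decay b 1 t ^ 2
    have hv : ∀ t ∈ Icc (0 : ℝ) 1, v t = 1 - xi β t ^ 2 := fun t ht ↦ by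
      simp only [v, hxi t ht]
    have hv0 : v 0 = 1 - tau β ^ 2 := hv 0 h0
    have hvm : Measurable v := by
      have := (continuous_decay hb 1).measurable
      fun_prop
    have hvpos : ∀ t ∈ Ico (0 : ℝ) 1, 0 < 1 - xi β t ^ 2 := fun t ht ↦ by
      nlinarith [hxi0 t, hxi1 t ht]
    -- Clearing the nested inverses reduces the stated mean and variance to the general formulas by
    -- field arithmetic; `ξ > τ` keeps the denominator nonzero there.
    have hσ : ∀ t ∈ Ioo (0 : ℝ) 1, sigmaSq β t =
        (1 - xi β t ^ 2) * (1 - tau β ^ 2) / (xi β t ^ 2 - tau β ^ 2) := fun t ht ↦ by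
      have h1 := (hvpos t (Ioo_subset_Ico_self ht)).ne'
      have h2 : (1 - tau β ^ 2) ≠ 0 := (hvpos 0 (by simp)).ne'
      rw [sigmaSq, sigma2Sq, sigma1Sq, div_sub_div _ _ h1 h2, inv_div]
      congr 1; ring
    refine isUniqueMinimizer_bridgeDrift a μ₁ (b := b) (γ := β') (v := v) hq
      hb (fun y r hr ↦ ?_) hβ' (fun r hr ↦ ?_) hvm (fun t ht ↦ ?_) (fun t ht ↦ ?_)
      (fun t ht ↦ ?_) (fun t ht x₁ ↦ ?_) (fun t ht ↦ ?_) (fun t ht x₁ x ↦ ?_)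
    · simp only [b, hββ r hr]
    · rw [hββ r hr, Real.sq_sqrt (hβ0 r hr)]
    · exact (integral_decay_sq_mul hβ' t).symm
    · rw [hv t (Ico_subset_Icc_self ht)]
      exact hvpos t ht
    · rw [hv t (Ioo_subset_Icc_self ht), hv0]
      nlinarith [hxit t ht, htau0]
    all_goals
      have ht' := Ioo_subset_Icc_self ht
      have h1 := (hvpos t (Ioo_subset_Ico_self ht)).ne'
      have h2 : (1 - tau β ^ 2) ≠ 0 := (hvpos 0 (by simp)).ne'
      have h3 := (hxi0 t).ne'
      have h4 : xi β t ^ 2 - tau β ^ 2 ≠ 0 := by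
        have := hxit t ht
        have : 0 < xi β t ^ 2 - tau β ^ 2 := by nlinarith
        exact this.ne'
    · rw [hv t ht', hv0, htau, hxi t ht', hσ t ht, sigma2Sq, sigma1Sq]
      congr 2
      field_simp
      ring
    · rw [hv t ht', hv0, hxi t ht', hσ t ht, sigma2Sq]
      field_simp
      ring
    · rw [hv t ht', hxi t ht', hββ t ht']
      congr 1; ring
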